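/- Let $T$ be a complete one-sorted first-order theory in a language $L$, and let $\mathbb M$ be a monster model of $T$: for some cardinal $\kappa > |L|+\aleph_0$, the structure $\mathbb M$ is $\kappa$-saturated and strongly $\kappa$-homogeneous. "Definable" means definable with parameters. Suppose that $T$ is t-minimal, that is, $\mathbb M$ carries a Hausdorff topology that has a basis forming a definable family $\{B_a : a\in D\}$ (with $D\subseteq\mathbb M^m$ definable), and a definable set $X\subseteq\mathbb M^1$ has non-empty interior if and only if it is infinite. Let $\mathbb M^{\mathrm{eq}}$ be the collection of classes of $\emptyset$-definable equivalence relations on finite powers of $\mathbb M$, and for $C\subseteq\mathbb M^{\mathrm{eq}}$ let $\operatorname{acl}(C)$ be the union of the finite $C$-definable sets. A tuple $\bar a\in\mathbb M^n$ is *acl-independent over $C$* if $a_i\notin\operatorname{acl}(C\cup\{a_j : j\ne i\})$ for every $i$. Tuples $\bar a,\bar b$ are *interalgebraic over $C$* if every $a_i$ lies in $\operatorname{acl}(C\bar b)$ and every $b_j$ lies in $\operatorname{acl}(C\bar a)$. A set $R\subseteq\mathbb M^n$ is *broad* if for every $k<\omega$ there are $S_1,\dots,S_n\subseteq\mathbb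 M$ with $|S_i|\ge k$ and $\prod_i S_i\subseteq R$; a type is broad if its set of realizations in $\mathbb M$ is broad. Then the following hold. 1. Let $C\subseteq\mathbb M^{\mathrm{eq}}$, and let $\bar a\in\mathbb M^n$, $\bar b\in\mathbb M^m$ be finite tuples that are interalgebraic over $C$. If both are acl-independent over $C$, then $n=m$. 2. Consequently $\dim(\bar a/C)$ is well-defined: for every $C\subseteq\mathbb M^{\mathrm{eq}}$ and every finite tuple $\bar a$ in $\mathbb M$ there is exactly one $d\in\mathbb N$ such that $\bar a$ is interalgebraic over $C$ with some acl-independent over $C$ tuple $\bar b\in\mathbb M^d$. 3. For every $n\ge 1$: - $(\mathbf A_n)$ There is no definable relation $R\subseteq\mathbb M^n\times\mathbb M^{n-1}$ such that the projections of $R$ to $\mathbb M^n$ and to $\mathbb M^{n-1}$ have finite fibers and the image of $R$ in $\mathbb M^n$ is broad. - $(\mathbf B_n)$ If $C\subseteq\mathbb M^{\mathrm{eq}}$, $\bar a\in\mathbb M^n$ and $\operatorname{tp}(\bar a/C)$ is broad, then $\bar a$ is not interalgebraic over $C$ with any tuple in $\mathbb M^{n-1}$. - $(\mathbf C_n)$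 If $C\subseteq\mathbb M^{\mathrm{eq}}$ is small ($|C|<\kappa$), $\bar a,\bar b\in\mathbb M^n$ are interalgebraic over $C$ and $\operatorname{tp}(\bar a/C)$ is broad, then $\operatorname{tp}(\bar b/C)$ is broad. -/

import Mathlib

open FirstOrder FirstOrder.Language

universe u v w

namespace TMin

section Monster

variable (L : FirstOrder.Language.{u, v}) (M : Type w) [L.Structure M]

/-- `M` is `κ`-saturated: a set of formulas in finitely many variables, with parameters from a set
`A` of fewer than `κ` elements, is realized in `M` as soon as it is finitely satisfiable in `M`. -/
def IsSaturated (κ : Cardinal.{w}) : Prop :=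
  ∀ A : Set M, Cardinal.mk A < κ → ∀ (n : ℕ) (p : Set (L[[A]].Formula (Fin n))),
    (∀ p₀ : Set (L[[A]].Formula (Fin n)), p₀ ⊆ p → p₀.Finite →
      ∃ x : Fin n → M, ∀ φ ∈ p₀, φ.Realize x) →
    ∃ x : Fin n → M, ∀ φ ∈ p, φ.Realize x

/-- `M` is strongly `κ`-homogeneous: a partial elementary map defined on a set of fewer than `κ`
elements extends to an automorphism. -/
def IsStronglyHomogeneous (κ : Cardinal.{w}) : Prop :=
  ∀ (A : Set M) (f : A → M), Cardinal.mk A < κ →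
    (∀ (n : ℕ) (φ : L.Formula (Fin n)) (x : Fin n → A),
      φ.Realize (fun i => (x i : M)) ↔ φ.Realize (fun i => f (x i))) →
    ∃ σ : M ≃[L] M, ∀ a : A, σ a = f a

/-- `M` is a monster model of its complete theory, where `small` means `< κ`. -/
structure IsMonster (κ : Cardinal.{w}) : Prop where
  aleph0_lt : Cardinal.aleph0 < κ
  card_lt : Cardinal.lift.{w} L.card < Cardinal.lift.{max u v} κ
  saturated : IsSaturated L M κ
  homogeneous : IsStronglyHomogeneous L M κ

end Monster

section Topology

variable (L : FirstOrder.Language.{u, v}) (M : Type w) [L.Structure M] [TopologicalSpace M]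

/-- The topology of `M` has a basis that is a definable family `(B a)`, `a ∈ D`
(definable with parameters). -/
def IsDefinableTopology : Prop :=
  ∃ (m : ℕ) (D : Set (Fin m → M)) (B : (Fin m → M) → Set M),
    (Set.univ : Set M).Definable L D ∧
    (Set.univ : Set M).Definable L
      {z : Fin 1 ⊕ Fin m → M | z ∘ Sum.inr ∈ D ∧ z (Sum.inl 0) ∈ B (z ∘ Sum.inr)} ∧
    TopologicalSpace.IsTopologicalBasis (B '' D)

/-- The topology of `M` is a Hausdorff definable topology for which a definable subset of the line
has non-empty interior if and only if it is infinite. -/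
structure IsTMinimal : Prop where
  t2 : T2Space M
  definable : IsDefinableTopology L M
  interior_nonempty_iff : ∀ D : Set M, (Set.univ : Set M).Definable₁ L D →
    ((interior D).Nonempty ↔ D.Infinite)

end Topology

section Imaginaries

variable (L : FirstOrder.Language.{u, v}) (M : Type w) [L.Structure M]

/-- A sort of `M^eq`: an equivalence relation on a finite power of `M` that is definable without
parameters. -/
structure EqSort where
  arity : ℕ
  rel : Setoid (Fin arity → M)
  definable : (∅ : Set M).Definable L
    {z : Fin arity ⊕ Fin arity → M | rel (z ∘ Sum.inl) (z ∘ Sum.inr)}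

/-- The elements of `M^eq`: the classes of the equivalence relations above. -/
structure MEq where
  srt : EqSort L M
  val : Quotient srt.rel

/-- The home sort of `M^eq`, given by equality on `M^1`. -/
abbrev homeSort : EqSort L M where
  arity := 1
  rel := ⊥
  definable := by
    rw [Set.empty_definable_iff]
    refine ⟨Term.equal (Term.var (Sum.inl 0)) (Term.var (Sum.inr 0)), ?_⟩
    ext z
    simp [funext_iff, Formula.realize_equal]

variable {M}

/-- An element of `M` as an element of `M^eq`. -/
abbrev home (a : M) : MEq L M := ⟨homeSort L M, Quotient.mk _ (fun _ => a)⟩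

/-- `X` is definable over `C ⊆ M^eq`: it is given by a formula `φ(x, e₁, …, e_k)` with `e_i ∈ C`,
that is, by a formula of `L` in which an imaginary `e_i` enters through an arbitrary
representative. -/
def DefinableOver (C : Set (MEq L M)) {α : Type} (X : Set (α → M)) : Prop :=
  ∃ (k : ℕ) (e : Fin k → MEq L M), (∀ i, e i ∈ C) ∧
    ∃ φ : L.Formula (α ⊕ (Σ i : Fin k, Fin (e i).srt.arity)),
      ∀ (x : α → M) (y : ∀ i : Fin k, Fin (e i).srt.arity → M),
        (∀ i, (Quotient.mk (e i).srt.rel (y i)) = (e i).val) →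
        (x ∈ X ↔ φ.Realize (Sum.elim x (fun p => y p.1 p.2)))

/-- The elements of `M` that are algebraic over `C ⊆ M^eq`. -/
def acl (C : Set (MEq L M)) : Set M :=
  {a | ∃ X : Set M, X.Finite ∧ a ∈ X ∧ DefinableOver L C {x : Fin 1 → M | x 0 ∈ X}}

/-- No `a i` is algebraic over `C` and the other coordinates. -/
def AclIndependent (C : Set (MEq L M)) {n : ℕ} (a : Fin n → M) : Prop :=
  ∀ i, a i ∉ acl L (C ∪ (fun j => home L (a j)) '' {j | j ≠ i})

/-- Each of the tuples `a` and `b` is algebraic over `C` and the other one. -/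
def Interalgebraic (C : Set (MEq L M)) {n m : ℕ} (a : Fin n → M) (b : Fin m → M) : Prop :=
  (∀ i, a i ∈ acl L (C ∪ Set.range (fun j => home L (b j)))) ∧
  (∀ j, b j ∈ acl L (C ∪ Set.range (fun i => home L (a i))))

/-- The set of realizations in `M` of the type `tp(a/C)`. -/
def typeSet (C : Set (MEq L M)) {n : ℕ} (a : Fin n → M) : Set (Fin n → M) :=
  {x | ∀ X : Set (Fin n → M), DefinableOver L C X → a ∈ X → x ∈ X}

end Imaginaries

/-- `R ⊆ M^n` is broad: it contains a `k × ⋯ × k` grid for every `k`. -/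
def Broad {M : Type w} {n : ℕ} (R : Set (Fin n → M)) : Prop :=
  ∀ k : ℕ, ∃ S : Fin n → Finset M, (∀ i, k ≤ (S i).card) ∧ {x | ∀ i, x i ∈ S i} ⊆ R

end TMin

/-! The heart of the matter is that a single element `b` is never interalgebraic over `C` with an
acl-independent pair `(a₁, a₂)`. Suppose the topology were definable over `C`. Since `b` is not
algebraic over `C a₁`, it would lie in the interior of a fibre `fib W₁ a₁` witnessing that `a₁` is
algebraic over `b`, and likewise for `a₂`. The points with such witnesses form an infinite definable
set, which contains an open set. On a smaller open set the fibres containing a point in their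
interior do not change, so only finitely many pairs occur; each is compatible with finitely many
points, yet non-empty open sets are infinite.

The topology may however need parameters `t` outside `C`, which cannot be added without risking the
independence of the given tuples. Instead, let `E` be the set of pairs `(x, y)` with `y` in the
fibre over `x` but not in its interior. Automorphisms fixing `C` move `t`, but they change `E` only
by finitely many pairs, with a uniform bound (`IsTMinimal.exists_interior_change_bound`). A set
moved so little differs finitely from an almost invariant function (`exists_almost_invariant`, an
averaging argument in `ℓ²`). This function vanishes at some conjugate of `(a₁, b)`, so almost no
conjugate lies in `E` (`IsTMinimal.mem_interior_fib_of_conj`), and the argument above applies to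
conjugates.

The statement for pairs is weaker than exchange but still forces independent sets with the same
closure to have equal size (`card_eq_of_indepOver`), which gives the dimension.

Broadness is linked to independence in two ways. By counting, a grid is not covered by finitely many
families with bounded fibres, so a broad type is independent, and saturation gives independent
points over finite parameter sets in broad definable sets (`IsMonster.exists_aclIndependent`).
Conversely, if the parameters define the topology, a definable set invariant over them that contains
an independent tuple contains large grids (`IsTMinimal.broad_of_aclIndependent`). Here enlarging the
parameters is harmless, since the independent tuple may be chosen afterwards. -/

namespace TMin

/-! ### Almost invariant functions by averaging in `ℓ²`. -/

section AlmostInvariant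

variable {X : Type*}

/-- The squared `ℓ²`-norm, meaningful for functions of finite support. -/
noncomputable def sqNorm (h : X → ℝ) : ℝ := ∑ᶠ x, h x ^ 2

theorem sqNorm_nonneg (h : X → ℝ) : 0 ≤ sqNorm h := finsum_nonneg fun _ => sq_nonneg _

theorem support_sq (h : X → ℝ) : Function.support (fun x => h x ^ 2) = Function.support h := by
  ext x; simp

theorem sq_le_sqNorm {h : X → ℝ} (hf : (Function.support h).Finite) (x : X) :
    h x ^ 2 ≤ sqNorm h :=
  single_le_finsum (f := fun x => h x ^ 2) x
    (by unfold Function.HasFiniteSupport; rw [support_sq]; exact hf) fun _ => sq_nonneg _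

theorem sqNorm_comp_equiv (h : X → ℝ) (e : X ≃ X) : sqNorm (h ∘ e) = sqNorm h :=
  finsum_comp_equiv (f := fun x => h x ^ 2) e

/-- The parallelogram identity. Finite supports are needed because a `finsum` with infinite support
is zero by convention. -/
theorem sqNorm_midpoint {h k : X → ℝ} (hh : (Function.support h).Finite)
    (hk : (Function.support k).Finite) :
    sqNorm (fun x => (h x + k x) / 2) =
      sqNorm h / 2 + sqNorm k / 2 - sqNorm (fun x => h x - k x) / 4 := by
  classical
  set s : Finset X := hh.toFinset ∪ hk.toFinset with hs
  have hzero : ∀ x, x ∉ s → h x = 0 ∧ k x = 0 := by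
    intro x hx
    simp only [hs, Finset.mem_union, Set.Finite.mem_toFinset, Function.mem_support] at hx
    exact ⟨not_not.1 fun h => hx (Or.inl h), not_not.1 fun h => hx (Or.inr h)⟩
  have key : ∀ F : X → ℝ, (∀ x, x ∉ s → F x = 0) → sqNorm F = ∑ x ∈ s, F x ^ 2 := by
    intro F hF
    refine finsum_eq_sum_of_support_subset _ fun x hx => ?_
    by_contra hxs
    exact hx (by simp [hF x hxs])
  rw [key _ fun x hx => by simp [hzero x hx], key h fun x hx => (hzero x hx).1,
    key k fun x hx => (hzero x hx).2, key _ fun x hx => by simp [hzero x hx],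
    Finset.sum_div, Finset.sum_div, Finset.sum_div, ← Finset.sum_add_distrib,
    ← Finset.sum_sub_distrib]
  exact Finset.sum_congr rfl fun x _ => by ring

variable {G : Type*} [Group G] [MulAction G X]

/-- The indicator function of the translate `g • E`. -/
noncomputable def translateIndicator (E : Set X) (g : G) (x : X) : ℝ :=
  E.indicator 1 (g⁻¹ • x)

theorem translateIndicator_smul (E : Set X) (g h : G) (x : X) :
    translateIndicator E g (h • x) = translateIndicator E (h⁻¹ * g) x := by
  simp [translateIndicator, mul_smul]

/-- A set that is moved by a group within a bounded symmetric difference is, up to a finitely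
supported function, arbitrarily close to an invariant function. -/
theorem exists_almost_invariant (E : Set X) (K : ℕ)
    (hE : ∀ g : G, {x | g⁻¹ • x ∈ E ∧ x ∉ E}.Finite ∧ {x | g⁻¹ • x ∈ E ∧ x ∉ E}.ncard ≤ K)
    {ε : ℝ} (hε : 0 < ε) :
    ∃ f : X → ℝ, {x | f x ≠ E.indicator 1 x}.Finite ∧
      ∀ (g : G) (x : X), |f (g • x) - f x| ≤ ε := by
  classical
  -- symmetric differences
  have hdiff : ∀ g : G, (Function.support
      fun x => E.indicator (1 : X → ℝ) x - translateIndicator E g x).Finite ∧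
      sqNorm (fun x => E.indicator (1 : X → ℝ) x - translateIndicator E g x) ≤ 2 * K := by
    intro g
    set s := {x | g⁻¹ • x ∈ E ∧ x ∉ E} with hs
    set t := {x | g • x ∈ E ∧ x ∉ E} with ht
    have ht' := hE g⁻¹
    rw [inv_inv] at ht'
    -- The half `E \ gE` of the symmetric difference is the `g`-translate of the half belonging to
    -- `g⁻¹`, so the one-sided hypothesis bounds the whole by `2 * K`.
    have hsub : (Function.support
      fun x => E.indicator (1 : X → ℝ) x - translateIndicator E g x) ⊆ s ∪ (g • ·) '' t := by
      intro x hx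
      by_cases h1 : x ∈ E <;> by_cases h2 : g⁻¹ • x ∈ E
      · simp [translateIndicator, h1, h2] at hx
      · exact Or.inr ⟨g⁻¹ • x, ⟨by simpa using h1, h2⟩, by simp⟩
      · exact Or.inl ⟨h2, h1⟩
      · simp [translateIndicator, h1, h2] at hx
    have hfin : (s ∪ (g • ·) '' t).Finite := (hE g).1.union (ht'.1.image _)
    refine ⟨hfin.subset hsub, ?_⟩
    have hcard : (s ∪ (g • ·) '' t).ncard ≤ 2 * K := by
      refine (Set.ncard_union_le _ _).trans ?_
      have : ((g • ·) '' t).ncard ≤ t.ncard := Set.ncard_image_le ht'.1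
      have h1 : s.ncard ≤ K := (hE g).2
      have h2 : t.ncard ≤ K := ht'.2
      omega
    rw [sqNorm, finsum_eq_sum_of_support_subset (s := hfin.toFinset) _
      (by rw [support_sq]; simpa using hsub)]
    calc _ ≤ ∑ x ∈ hfin.toFinset, (1 : ℝ) := Finset.sum_le_sum fun x _ => by
            by_cases h1 : x ∈ E <;> by_cases h2 : g⁻¹ • x ∈ E <;>
              simp [translateIndicator, h1, h2]
      _ = ((s ∪ (g • ·) '' t).ncard : ℝ) := by
            rw [Set.ncard_eq_toFinset_card _ hfin]; simp
      _ ≤ 2 * K := by exact_mod_cast hcard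
  -- admissible functions
  let P : Set (X → ℝ) := {f | (Function.support fun x => f x - E.indicator 1 x).Finite}
  have hPg : ∀ f ∈ P, ∀ g : G,
      (Function.support fun x => f x - translateIndicator E g x).Finite := by
    intro f hf g
    refine (hf.union (hdiff g).1).subset fun x hx => ?_
    by_contra hcon
    simp only [Set.mem_union, Function.mem_support, not_or, not_not] at hcon
    exact hx (by linarith [hcon.1, hcon.2])
  -- The squared radii of balls, centred at admissible functions, that contain every translate of
  -- the indicator of `E`.
  let R : Set ℝ := {r | ∃ f ∈ P, ∀ g : G, sqNorm (fun x => f x - translateIndicator E g x) ≤ r}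
  have hRne : R.Nonempty := ⟨2 * K, E.indicator 1, by simp [P], fun g => (hdiff g).2⟩
  have hRbdd : BddBelow R :=
    ⟨0, fun r ⟨f, _, hf⟩ => (sqNorm_nonneg _).trans (hf 1)⟩
  -- An approximate centre suffices. If `f` were moved by more than `ε` in norm, the midpoint of `f`
  -- and its translate would lower the squared radius by more than `ε ^ 2 / 4`, below the infimum.
  obtain ⟨r, ⟨f, hfP, hfr⟩, hr⟩ :=
    exists_lt_of_csInf_lt hRne (show sInf R < sInf R + ε ^ 2 / 4 by have := pow_pos hε 2; linarith)
  refine ⟨f, ?_, fun h y => ?_⟩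
  · refine Set.Finite.subset hfP fun x hx => ?_
    simpa [sub_eq_zero] using hx
  -- the translate of `f` is admissible with the same radius
  have hshift : ∀ g : G, (fun x => f (h • x) - translateIndicator E g x) =
      (fun x => f x - translateIndicator E (h * g) x) ∘ (MulAction.toPerm h) := by
    intro g
    funext x
    simp [translateIndicator_smul, ← mul_assoc]
  have hfin1 : ∀ g : G, (Function.support fun x => f x - translateIndicator E g x).Finite :=
    hPg f hfP
  have hfin2 : ∀ g : G,
      (Function.support fun x => f (h • x) - translateIndicator E g x).Finite := by
    intro g
    rw [hshift, Function.support_comp_eq_preimage]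
    exact (hPg f hfP _).preimage (MulAction.toPerm h).injective.injOn
  have hmid : ∀ g : G, sqNorm (fun x => (f x + f (h • x)) / 2 - translateIndicator E g x) ≤
      r - sqNorm (fun x => f x - f (h • x)) / 4 := by
    intro g
    have e1 : (fun x => (f x + f (h • x)) / 2 - translateIndicator E g x) =
        fun x => ((f x - translateIndicator E g x) +
          (f (h • x) - translateIndicator E g x)) / 2 := by
      funext x; ring
    rw [e1, sqNorm_midpoint (hfin1 g) (hfin2 g)]
    have e2 : sqNorm (fun x => f (h • x) - translateIndicator E g x) ≤ r := by
      rw [hshift, sqNorm_comp_equiv]; exact hfr _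
    have e3 : (fun x => (f x - translateIndicator E g x) -
          (f (h • x) - translateIndicator E g x)) = fun x => f x - f (h • x) := by
      funext x; ring
    rw [e3]
    linarith [hfr g]
  have hone : translateIndicator E (1 : G) = E.indicator 1 := by
    funext x; simp [translateIndicator]
  have hmem : r - sqNorm (fun x => f x - f (h • x)) / 4 ∈ R := by
    refine ⟨_, ?_, hmid⟩
    refine ((hfin1 1).union (hfin2 1)).subset fun x hx => ?_
    by_contra hcon
    simp only [Set.mem_union, Function.mem_support, not_or, not_not, hone] at hcon
    exact hx (by linarith [hcon.1, hcon.2])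
  have hle := csInf_le hRbdd hmem
  have hfin3 : (Function.support fun x => f x - f (h • x)).Finite := by
    refine ((hfin1 1).union (hfin2 1)).subset fun x hx => ?_
    by_contra hcon
    simp only [Set.mem_union, Function.mem_support, not_or, not_not] at hcon
    exact hx (by linarith [hcon.1, hcon.2])
  have hsq := sq_le_sqNorm hfin3 y
  rw [abs_sub_comm]
  exact abs_le_of_sq_le_sq (by linarith) hε.le

end AlmostInvariant

/-! ### Equal size of bases from a weak form of exchange. -/

section Closure

variable {M : Type*}

/-- `I` is independent over `B` for the operator `cl`. -/
def IndepOver (cl : Set M → Set M) (B : Set M) (I : Finset M) : Prop :=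
  ∀ x ∈ I, x ∉ cl (B ∪ (I \ {x} : Set M))

variable {cl : Set M → Set M}

-- Dependent elements are discarded one at a time, and idempotence keeps the closure unchanged. No
-- exchange is used, so nothing is claimed yet about the size of the result.
open Classical in
theorem exists_basis (ext : ∀ S, S ⊆ cl S)
    (idem : ∀ {S T}, S ⊆ cl T → cl S ⊆ cl T) (B : Set M) (J : Finset M) :
    ∃ I ⊆ J, IndepOver cl B I ∧ (J : Set M) ⊆ cl (B ∪ I) := by
  induction hn : J.card generalizing J with
  | zero =>
    refine ⟨J, subset_rfl, ?_, ?_⟩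
    · rw [Finset.card_eq_zero] at hn; simp [IndepOver, hn]
    · exact Set.subset_union_right.trans (ext _)
  | succ n ih =>
    by_cases hJ : IndepOver cl B J
    · exact ⟨J, subset_rfl, hJ, Set.subset_union_right.trans (ext _)⟩
    · simp only [IndepOver, not_forall, not_not] at hJ
      obtain ⟨x, hx, hxcl⟩ := hJ
      obtain ⟨I, hI, hind, hcl⟩ := ih (J.erase x) (by rw [Finset.card_erase_of_mem hx, hn]; rfl)
      refine ⟨I, hI.trans (Finset.erase_subset _ _), hind, fun y hy => ?_⟩
      by_cases hyx : y = x
      · subst hyx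
        refine idem ?_ hxcl
        rintro z (hz | hz)
        · exact ext _ (Or.inl hz)
        · exact hcl (by simpa [and_comm] using hz)
      · exact hcl (by simp [hyx]; exact hy)

/-- In a closure operator for which no element is interdependent with an independent pair,
independent sets that generate the same closure have the same size. -/
theorem card_eq_of_indepOver (mono : ∀ {S T}, S ⊆ T → cl S ⊆ cl T) (ext : ∀ S, S ⊆ cl S)
    (idem : ∀ {S T}, S ⊆ cl T → cl S ⊆ cl T)
    (pair : ∀ (B : Set M) (x y b : M), x ∈ cl (insert b B) → y ∈ cl (insert b B) →
      b ∈ cl (insert x (insert y B)) → x ∈ cl (insert y B) ∨ y ∈ cl (insert x B))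
    {B : Set M} {I J : Finset M} (hI : IndepOver cl B I) (hJ : IndepOver cl B J)
    (hIJ : (I : Set M) ⊆ cl (B ∪ J)) (hJI : (J : Set M) ⊆ cl (B ∪ I)) : I.card = J.card := by
  classical
  -- If the second set is a single `b` and the first contains distinct `x` and `y`, then `pair`
  -- applies over the base enlarged by the rest of `I`.
  have one : ∀ (B : Set M) (I J : Finset M), IndepOver cl B I → IndepOver cl B J →
      (I : Set M) ⊆ cl (B ∪ J) → (J : Set M) ⊆ cl (B ∪ I) → J.card ≤ 1 → I.card = J.card := by
    intro B I J hI hJ hIJ hJI hcard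
    rcases Nat.le_one_iff_eq_zero_or_eq_one.1 hcard with h0 | h1
    · rw [Finset.card_eq_zero] at h0
      subst h0
      rw [Finset.card_empty, Finset.card_eq_zero, Finset.eq_empty_iff_forall_notMem]
      intro x hx
      exact hI x hx (mono (Set.union_subset_union_right _ (by simp)) (hIJ hx))
    · obtain ⟨b, rfl⟩ := Finset.card_eq_one.1 h1
      rw [Finset.card_singleton]
      by_contra hne
      rcases Nat.lt_or_ge I.card 1 with hlt | hge
      · rw [Nat.lt_one_iff, Finset.card_eq_zero] at hlt
        subst hlt
        exact hJ b (by simp) (mono (by simp) (hJI (by simp : b ∈ _)))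
      · obtain ⟨x, hx, y, hy, hxy⟩ := Finset.one_lt_card.1 (by omega : 1 < I.card)
        have hsub : ∀ z, B ∪ ({b} : Finset M) ⊆ insert z (insert b (B ∪ (I \ {x, y} : Set M))) := by
          intro z w hw
          simp only [Finset.coe_singleton, Set.mem_union, Set.mem_singleton_iff] at hw
          simp only [Set.mem_insert_iff, Set.mem_union]
          tauto
        have hins : insert x (insert y (B ∪ (I \ {x, y} : Set M))) = B ∪ I := by
          ext z
          by_cases h1 : z = x
          · subst h1; simp [hx]
          · by_cases h2 : z = y
            · subst h2; simp [hy]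
            · simp [h1, h2]
        rcases pair (B ∪ (I \ {x, y} : Set M)) x y b
          (mono (fun w hw => by
            simp only [Finset.coe_singleton, Set.mem_union, Set.mem_singleton_iff] at hw
            simp only [Set.mem_insert_iff, Set.mem_union]; tauto) (hIJ hx))
          (mono (fun w hw => by
            simp only [Finset.coe_singleton, Set.mem_union, Set.mem_singleton_iff] at hw
            simp only [Set.mem_insert_iff, Set.mem_union]; tauto) (hIJ hy))
          (by rw [hins]; exact hJI (by simp : b ∈ _)) with h | h
        · refine hI x hx (mono ?_ h)
          rintro w (rfl | hw | hw)
          · exact Or.inr ⟨hy, by simpa using Ne.symm hxy⟩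
          · exact Or.inl hw
          · exact Or.inr ⟨hw.1, fun h => hw.2 (Or.inl h)⟩
        · refine hI y hy (mono ?_ h)
          rintro w (rfl | hw | hw)
          · exact Or.inr ⟨hx, by simpa using hxy⟩
          · exact Or.inl hw
          · exact Or.inr ⟨hw.1, fun h => hw.2 (Or.inr h)⟩
  have erase : ∀ {B : Set M} {I : Finset M} {i : M}, IndepOver cl B I → i ∈ I →
      IndepOver cl (insert i B) (I.erase i) := by
    intro B I i hI hi x hx hcl
    rw [Finset.mem_erase] at hx
    refine hI x hx.2 (mono ?_ hcl)
    rintro w ((rfl | hw) | hw)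
    · exact Or.inr ⟨hi, by simpa using Ne.symm hx.1⟩
    · exact Or.inl hw
    · simp only [Finset.coe_erase, Set.mem_sdiff, Set.mem_singleton_iff] at hw
      exact Or.inr ⟨hw.1.1, hw.2⟩
  have ins_erase : ∀ {B : Set M} {I : Finset M} {i : M}, i ∈ I →
      insert i B ∪ (I.erase i : Set M) = B ∪ I := by
    intro B I i hi
    ext w
    by_cases h : w = i
    · subst h; simp [hi]
    · simp [h]
  -- Induction on a bound for the smaller size, for all bases at once. The remaining case is `J.card
  -- = m + 1` and `I.card ≥ m + 2`.
  have main : ∀ (m : ℕ) (B : Set M) (I J : Finset M), IndepOver cl B I → IndepOver cl B J →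
      (I : Set M) ⊆ cl (B ∪ J) → (J : Set M) ⊆ cl (B ∪ I) → J.card ≤ m → I.card = J.card := by
    intro m
    induction m with
    | zero => exact fun B I J h1 h2 h3 h4 h5 => one B I J h1 h2 h3 h4 (by omega)
    | succ m ih =>
      intro B I J hI hJ hIJ hJI hcard
      rcases Nat.lt_or_ge J.card 2 with hlt | hge
      · exact one B I J hI hJ hIJ hJI (by omega)
      rcases Nat.lt_or_ge m J.card with hJm | hJm
      swap
      · exact ih B I J hI hJ hIJ hJI hJm
      rcases Nat.lt_or_ge m I.card with hIm | hIm
      swap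
      · exact (ih B J I hJ hI hJI hIJ hIm).symm
      by_contra hne
      -- Adding `i` to the base keeps `J` independent: otherwise a basis of `J` over `i` has at most
      -- `m` elements, and induction gives `I` without `i` that same size, which is too small.
      have hJI' : ∀ i ∈ I, IndepOver cl (insert i B) J := by
        intro i hi
        obtain ⟨J', hJ', hind, hgen⟩ := exists_basis ext idem (insert i B) J
        rcases (Finset.card_le_card hJ').lt_or_eq with hlt | heq
        · exfalso
          have := ih (insert i B) (I.erase i) J' (erase hI hi) hind
            (by
              refine Set.Subset.trans ?_ (idem (S := B ∪ J) ?_)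
              · exact Set.Subset.trans (by simp) hIJ
              · rintro w (hw | hw)
                · exact ext _ (Or.inl (Or.inr hw))
                · exact hgen hw)
            (by
              rw [ins_erase hi]
              exact Set.Subset.trans (by exact_mod_cast hJ') hJI) (by omega)
          rw [Finset.card_erase_of_mem hi] at this
          omega
        · rwa [Finset.eq_of_subset_of_card_le hJ' heq.ge] at hind
      obtain ⟨b, hb⟩ := Finset.card_pos.1 (by omega : 0 < J.card)
      obtain ⟨I', hI', hind, hgen⟩ := exists_basis ext idem (insert b B) I
      have hJb : (J.erase b : Set M) ⊆ cl (insert b B ∪ I') := by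
        refine Set.Subset.trans (Set.Subset.trans (by simp) hJI) (idem ?_)
        rintro w (hw | hw)
        · exact ext _ (Or.inl (Or.inr hw))
        · exact hgen hw
      have hcardI' := ih (insert b B) I' (J.erase b) hind (erase hJ hb)
        (by rw [ins_erase hb]; exact Set.Subset.trans (by exact_mod_cast hI') hIJ) hJb
        (by rw [Finset.card_erase_of_mem hb]; omega)
      rw [Finset.card_erase_of_mem hb] at hcardI'
      obtain ⟨i, hi⟩ := Finset.card_pos.1 (by omega : 0 < I'.card)
      -- Over `i` and `b` together, `I'` without `i` and `J` without `b` are independent with the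
      -- same closure. Induction makes their sizes equal, although `I'` and `J` without `b` already
      -- had equal size.
      have h1 := erase hind hi
      have h2 := erase (hJI' i (hI' hi)) hb
      rw [Set.insert_comm] at h2
      have := ih _ (I'.erase i) (J.erase b) h1 h2
        (by
          rw [Set.insert_comm, ins_erase hb]
          refine Set.Subset.trans (Set.Subset.trans ?_ hIJ) (mono ?_)
          · exact Set.Subset.trans (by simp) (Finset.coe_subset.2 hI')
          · exact Set.union_subset_union_left _ (Set.subset_insert _ _))
        (by rw [ins_erase hi]; exact hJb) (by rw [Finset.card_erase_of_mem hb]; omega)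
      rw [Finset.card_erase_of_mem hi, Finset.card_erase_of_mem hb] at this
      omega
  exact main _ B I J hI hJ hIJ hJI le_rfl

end Closure

/-! ### Definability and algebraic closure over imaginaries. -/

section Calculus

variable {L : FirstOrder.Language.{u, v}} {M : Type w} [L.Structure M]

/-- The variables needed to speak about representatives of the elements of `C`. -/
abbrev Params (C : Set (MEq L M)) : Type w := Σ e : C, Fin e.1.srt.arity

/-- `y` consists of representatives of the elements of `C`. -/
def IsRep (C : Set (MEq L M)) (y : Params C → M) : Prop :=
  ∀ e : C, Quotient.mk e.1.srt.rel (fun i => y ⟨e, i⟩) = e.1.val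

theorem exists_isRep (C : Set (MEq L M)) : ∃ y, IsRep C y := by
  choose y hy using fun e : C => Quotient.exists_rep e.1.val
  exact ⟨fun p => y p.1 p.2, hy⟩

theorem mk_cast_eq {e e' : MEq L M} (h : e = e') (y : Fin e.srt.arity → M)
    (hy : Quotient.mk e.srt.rel y = e.val) :
    Quotient.mk e'.srt.rel (fun j => y (Fin.cast (by rw [h]) j)) = e'.val := by
  subst h
  exact hy

/-- Using variables for representatives of all of `C` at once gives every set the same parameter
variables, which makes Boolean operations and quantifiers immediate. Only finitely many of the
variables occur in a formula. -/
theorem definableOver_iff {C : Set (MEq L M)} {α : Type} {X : Set (α → M)} :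
    DefinableOver L C X ↔ ∃ φ : L.Formula (α ⊕ Params C),
      ∀ y, IsRep C y → ∀ x, x ∈ X ↔ φ.Realize (Sum.elim x y) := by
  classical
  constructor
  · rintro ⟨k, e, he, φ, hφ⟩
    refine ⟨φ.relabel (Sum.map id fun p => ⟨⟨e p.1, he p.1⟩, p.2⟩), fun y hy x => ?_⟩
    rw [hφ x (fun i j => y ⟨⟨e i, he i⟩, j⟩) fun i => hy ⟨e i, he i⟩, Formula.realize_relabel]
    congr! 1
    ext (a | p) <;> rfl
  · rintro ⟨φ, hφ⟩
    set E : Finset C := (BoundedFormula.freeVarFinset φ).toRight.image (fun p => p.1) with hE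
    have hmem : ∀ p : Params C, Sum.inr p ∈ φ.freeVarFinset → p.1 ∈ E := fun p hp =>
      Finset.mem_image_of_mem _ (by simpa using hp)
    let e : Fin E.card → MEq L M := fun i => (E.equivFin.symm i).1.1
    have he : ∀ (c : C) (hc : c ∈ E), e (E.equivFin ⟨c, hc⟩) = c.1 := by
      intro c hc; simp [e]
    refine ⟨E.card, e, fun i => (E.equivFin.symm i).1.2, φ.restrictFreeVar (fun z =>
      Sum.casesOn (motive := fun t => t ∈ φ.freeVarFinset → α ⊕ Σ i, Fin (e i).srt.arity) z.1
        (fun a _ => Sum.inl a)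
        (fun p hp => Sum.inr ⟨E.equivFin ⟨p.1, hmem p hp⟩, Fin.cast (by rw [he]) p.2⟩) z.2),
      fun x y hy => ?_⟩
    obtain ⟨y₀, hy₀⟩ := exists_isRep C
    -- Representatives of the elements not mentioned by the formula are irrelevant and are filled in
    -- from `y₀`.
    let y' : Params C → M := fun p =>
      if h : p.1 ∈ E then y (E.equivFin ⟨p.1, h⟩) (Fin.cast (by rw [he]) p.2) else y₀ p
    have hy' : IsRep C y' := by
      intro c
      by_cases h : c ∈ E
      · have := mk_cast_eq (he c h) (y (E.equivFin ⟨c, h⟩)) (hy _)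
        simpa [y', h] using this
      · simpa [y', h] using hy₀ c
    rw [hφ y' hy' x]
    refine (BoundedFormula.realize_restrictFreeVar _ ?_).symm
    rintro ⟨a | p, hp⟩
    · rfl
    · simp [y', hmem p hp]

theorem DefinableOver.mono {C C' : Set (MEq L M)} (hC : C ⊆ C') {α : Type} {X : Set (α → M)}
    (h : DefinableOver L C X) : DefinableOver L C' X := by
  obtain ⟨k, e, he, h⟩ := h
  exact ⟨k, e, fun i => hC (he i), h⟩

theorem DefinableOver.exists_finite {C : Set (MEq L M)} {α : Type} {X : Set (α → M)}
    (h : DefinableOver L C X) : ∃ C₀ ⊆ C, C₀.Finite ∧ DefinableOver L C₀ X := by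
  obtain ⟨k, e, he, h⟩ := h
  exact ⟨Set.range e, Set.range_subset_iff.2 he, Set.finite_range e, k, e, Set.mem_range_self, h⟩

theorem DefinableOver.compl {C : Set (MEq L M)} {α : Type} {X : Set (α → M)}
    (h : DefinableOver L C X) : DefinableOver L C Xᶜ := by
  rw [definableOver_iff] at *
  obtain ⟨φ, hφ⟩ := h
  exact ⟨φ.not, fun y hy x => by rw [Formula.realize_not, ← hφ y hy]; rfl⟩

theorem DefinableOver.inter {C : Set (MEq L M)} {α : Type} {X Y : Set (α → M)}
    (hX : DefinableOver L C X) (hY : DefinableOver L C Y) : DefinableOver L C (X ∩ Y) := by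
  rw [definableOver_iff] at *
  obtain ⟨φ, hφ⟩ := hX
  obtain ⟨ψ, hψ⟩ := hY
  exact ⟨φ ⊓ ψ, fun y hy x => by
    rw [Formula.realize_inf, ← hφ y hy, ← hψ y hy]; rfl⟩

theorem DefinableOver.union {C : Set (MEq L M)} {α : Type} {X Y : Set (α → M)}
    (hX : DefinableOver L C X) (hY : DefinableOver L C Y) : DefinableOver L C (X ∪ Y) := by
  rw [← compl_compl (X ∪ Y), Set.compl_union]
  exact (hX.compl.inter hY.compl).compl

theorem DefinableOver.preimage_comp {C : Set (MEq L M)} {α β : Type} (f : α → β)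
    {X : Set (α → M)} (h : DefinableOver L C X) :
    DefinableOver L C {w : β → M | w ∘ f ∈ X} := by
  rw [definableOver_iff] at *
  obtain ⟨φ, hφ⟩ := h
  refine ⟨φ.relabel (Sum.map f id), fun y hy x => ?_⟩
  rw [Formula.realize_relabel, Set.mem_ofPred_eq, hφ y hy]
  congr! 1
  ext (a | p) <;> rfl

theorem DefinableOver.exists_of_finite {C : Set (MEq L M)} {α β : Type} [Finite β]
    {X : Set (α ⊕ β → M)} (h : DefinableOver L C X) :
    DefinableOver L C {x : α → M | ∃ z : β → M, Sum.elim x z ∈ X} := by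
  rw [definableOver_iff] at *
  obtain ⟨φ, hφ⟩ := h
  refine ⟨Formula.iExs β (φ.relabel (Sum.elim (Sum.elim (Sum.inl ∘ Sum.inl) Sum.inr)
    (Sum.inl ∘ Sum.inr))), fun y hy x => ?_⟩
  rw [Formula.realize_iExs]
  refine exists_congr fun z => ?_
  rw [hφ y hy, Formula.realize_relabel]
  congr! 1
  ext ((a | p) | q) <;> rfl

theorem DefinableOver.forall_of_finite {C : Set (MEq L M)} {α β : Type} [Finite β]
    {X : Set (α ⊕ β → M)} (h : DefinableOver L C X) :
    DefinableOver L C {x : α → M | ∀ z : β → M, Sum.elim x z ∈ X} := by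
  convert h.compl.exists_of_finite.compl using 1
  ext x
  simp

theorem DefinableOver.iInter_of_finite {C : Set (MEq L M)} {α : Type} {ι : Type*} [Finite ι]
    {X : ι → Set (α → M)} (h : ∀ i, DefinableOver L C (X i)) :
    DefinableOver L C (⋂ i, X i) := by
  cases nonempty_fintype ι
  simp only [definableOver_iff] at *
  choose φ hφ using h
  refine ⟨Formula.iInf φ, fun y hy x => ?_⟩
  simp [Formula.realize_iInf, hφ _ y hy]

theorem DefinableOver.iUnion_of_finite {C : Set (MEq L M)} {α : Type} {ι : Type*} [Finite ι]
    {X : ι → Set (α → M)} (h : ∀ i, DefinableOver L C (X i)) :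
    DefinableOver L C (⋃ i, X i) := by
  rw [← compl_compl (⋃ i, X i), Set.compl_iUnion]
  exact (DefinableOver.iInter_of_finite fun i => (h i).compl).compl

theorem definableOver_of_formula (C : Set (MEq L M)) {α : Type} (φ : L.Formula α) :
    DefinableOver L C {x : α → M | φ.Realize x} := by
  rw [definableOver_iff]
  refine ⟨φ.relabel Sum.inl, fun y _ x => ?_⟩
  rw [Formula.realize_relabel]
  rfl

theorem definableOver_eq (C : Set (MEq L M)) {α : Type} (i j : α) :
    DefinableOver L C {x : α → M | x i = x j} := by
  convert definableOver_of_formula C (Term.equal (Term.var i) (Term.var j) : L.Formula α) using 1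
  ext x
  simp [Formula.realize_equal]

theorem DefinableOver.definable_range {C : Set (MEq L M)} {α : Type} {X : Set (α → M)}
    (h : DefinableOver L C X) {y : Params C → M} (hy : IsRep C y) :
    (Set.range y).Definable L X := by
  rw [definableOver_iff] at h
  obtain ⟨φ, hφ⟩ := h
  rw [Set.definable_iff_exists_formula_sum]
  refine ⟨φ.relabel (Sum.elim Sum.inr fun p => Sum.inl ⟨y p, p, rfl⟩), ?_⟩
  ext x
  rw [hφ y hy, Set.mem_ofPred_eq, Formula.realize_relabel]
  congr! 1
  ext (a | p) <;> rfl

theorem DefinableOver.definable_univ {C : Set (MEq L M)} {α : Type} {X : Set (α → M)}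
    (h : DefinableOver L C X) : (Set.univ : Set M).Definable L X := by
  obtain ⟨y, hy⟩ := exists_isRep C
  exact (h.definable_range hy).mono (Set.subset_univ _)

/-- Given one system of representatives, being another is first-order, since the equivalence
relations are `∅`-definable. Quantifying over all systems makes the set independent of the choice.
-/
theorem definableOver_exists_isRep {C : Set (MEq L M)} [Finite C] {α : Type}
    (ψ : L.Formula (α ⊕ Params C)) :
    DefinableOver L C {x : α → M | ∃ y, IsRep C y ∧ ψ.Realize (Sum.elim x y)} := by
  have hfin : Finite (Params C) := inferInstance
  cases nonempty_fintype C
  have hρ : ∀ e : C, ∃ ρ : L.Formula (Fin e.1.srt.arity ⊕ Fin e.1.srt.arity),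
      ∀ z : Fin e.1.srt.arity ⊕ Fin e.1.srt.arity → M,
        ρ.Realize z ↔ e.1.srt.rel (z ∘ Sum.inl) (z ∘ Sum.inr) := by
    intro e
    obtain ⟨ρ, hρ⟩ := Set.empty_definable_iff.1 e.1.srt.definable
    exact ⟨ρ, fun z => (Set.ext_iff.1 hρ z).symm⟩
  choose ρ hρ using hρ
  rw [definableOver_iff]
  refine ⟨Formula.iExs (Params C) (ψ.relabel (Sum.elim (Sum.inl ∘ Sum.inl) Sum.inr) ⊓
    Formula.iInf fun e : C => (ρ e).relabel (Sum.elim (fun i => Sum.inr ⟨e, i⟩)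
      fun i => Sum.inl (Sum.inr ⟨e, i⟩))), fun y hy x => ?_⟩
  rw [Formula.realize_iExs]
  refine exists_congr fun z => ?_
  rw [Formula.realize_inf, Formula.realize_iInf, Formula.realize_relabel, and_comm]
  refine and_congr ?_ ?_
  · rw [show (Sum.elim (Sum.elim x y) z ∘ Sum.elim (Sum.inl ∘ Sum.inl) Sum.inr) = Sum.elim x z by
      ext (a | p) <;> rfl]
  · refine forall_congr' fun e => ?_
    rw [Formula.realize_relabel, hρ, ← hy e, Quotient.eq]
    rfl

/-- Elements of the home sort as parameters can be replaced by variables. -/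
theorem definableOver_union_range_home {C : Set (MEq L M)} {α ι : Type} {b : ι → M}
    {X : Set (α → M)} :
    DefinableOver L (C ∪ Set.range fun i => home L (b i)) X ↔
      ∃ Y : Set (α ⊕ ι → M), DefinableOver L C Y ∧ ∀ x, x ∈ X ↔ Sum.elim x b ∈ Y := by
  classical
  constructor
  · intro h
    -- With finitely many imaginaries one can quantify over their representatives. This is needed
    -- because, at values other than `b`, the formula may depend on the representatives chosen.
    obtain ⟨C₁, hC₁, hfin, h⟩ := h.exists_finite
    suffices ∃ Y : Set (α ⊕ ι → M), DefinableOver L (C₁ ∩ C) Y ∧ ∀ x, x ∈ X ↔ Sum.elim x b ∈ Y by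
      obtain ⟨Y, hY, hXY⟩ := this
      exact ⟨Y, hY.mono Set.inter_subset_right, hXY⟩
    replace h : DefinableOver L ((C₁ ∩ C) ∪ Set.range fun i => home L (b i)) X :=
      h.mono fun e he => (hC₁ he).imp (fun h => ⟨he, h⟩) id
    have : Finite ↥(C₁ ∩ C) := hfin.subset Set.inter_subset_left
    clear hC₁
    generalize C₁ ∩ C = C at h this ⊢
    rw [definableOver_iff] at h
    obtain ⟨φ, hφ⟩ := h
    have hch : ∀ e : (C ∪ Set.range fun i => home L (b i) : Set (MEq L M)),
        e.1 ∉ C → ∃ i, home L (b i) = e.1 := fun e he => e.2.resolve_left he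
    choose f hf using hch
    let g : α ⊕ Params (C ∪ Set.range fun i => home L (b i)) → (α ⊕ ι) ⊕ Params C :=
      Sum.elim (Sum.inl ∘ Sum.inl) fun p =>
        if h : p.1.1 ∈ C then Sum.inr ⟨⟨p.1.1, h⟩, p.2⟩ else Sum.inl (Sum.inr (f p.1 h))
    have key : ∀ (y : Params C → M), IsRep C y → ∀ x, x ∈ X ↔
        (φ.relabel g).Realize (Sum.elim (Sum.elim x b) y) := by
      intro y hy x
      let y' : Params (C ∪ Set.range fun i => home L (b i)) → M := fun p =>
        if h : p.1.1 ∈ C then y ⟨⟨p.1.1, h⟩, p.2⟩ else b (f p.1 h)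
      have hy' : IsRep _ y' := by
        intro e
        by_cases h : e.1 ∈ C
        · simpa [y', h] using hy ⟨e.1, h⟩
        · have h2 := mk_cast_eq (hf e h) (fun _ => b (f e h)) rfl
          simpa [y', h] using h2
      rw [hφ y' hy' x, Formula.realize_relabel]
      congr! 1
      ext (a | p)
      · rfl
      · by_cases h : p.1.1 ∈ C <;> simp [g, y', h]
    refine ⟨_, definableOver_exists_isRep (φ.relabel g), fun x => ⟨fun hx => ?_, ?_⟩⟩
    · obtain ⟨y, hy⟩ := exists_isRep C
      exact ⟨y, hy, (key y hy x).1 hx⟩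
    · rintro ⟨y, hy, hx⟩
      exact (key y hy x).2 hx
  · rintro ⟨Y, hY, hXY⟩
    rw [definableOver_iff] at *
    obtain ⟨φ, hφ⟩ := hY
    let g : (α ⊕ ι) ⊕ Params C → α ⊕ Params (C ∪ Set.range fun i => home L (b i)) :=
      Sum.elim (Sum.elim Sum.inl fun i => Sum.inr ⟨⟨home L (b i), Or.inr ⟨i, rfl⟩⟩, 0⟩)
        fun p => Sum.inr ⟨⟨p.1.1, Or.inl p.1.2⟩, p.2⟩
    refine ⟨φ.relabel g, fun y hy x => ?_⟩
    have hyC : IsRep C fun p => y ⟨⟨p.1.1, Or.inl p.1.2⟩, p.2⟩ :=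
      fun e => hy ⟨e.1, Or.inl e.2⟩
    rw [hXY, hφ _ hyC, Formula.realize_relabel]
    congr! 1
    ext ((a | i) | p)
    · rfl
    · have := hy ⟨home L (b i), Or.inr ⟨i, rfl⟩⟩
      have h2 : (fun j => y ⟨⟨home L (b i), Or.inr ⟨i, rfl⟩⟩, j⟩) = fun _ : Fin 1 => b i :=
        Quotient.exact this
      exact (congrFun h2 0).symm
    · rfl

theorem acl_mono {C C' : Set (MEq L M)} (h : C ⊆ C') : acl L C ⊆ acl L C' :=
  fun _ ⟨X, hX, ha, hd⟩ => ⟨X, hX, ha, hd.mono h⟩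

theorem acl_exists_finite {C : Set (MEq L M)} {a : M} (h : a ∈ acl L C) :
    ∃ C₀ ⊆ C, C₀.Finite ∧ a ∈ acl L C₀ := by
  obtain ⟨X, hX, ha, hd⟩ := h
  obtain ⟨C₀, hC₀, hfin, hd⟩ := hd.exists_finite
  exact ⟨C₀, hC₀, hfin, X, hX, ha, hd⟩

/-- A set `W` of pairs `(y, v)` all of whose fibres over `v` have at most `N` elements. -/
def BoundedFibers {ι : Type} (N : ℕ) (W : Set (Fin 1 ⊕ ι → M)) : Prop :=
  ∀ v : ι → M, {y : M | Sum.elim (fun _ => y) v ∈ W}.Finite ∧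
    {y : M | Sum.elim (fun _ => y) v ∈ W}.ncard ≤ N

theorem elim_fin_one {ι : Type} (x : Fin 1 → M) (v : ι → M) :
    Sum.elim x v = Sum.elim (fun _ => x 0) v := by
  ext (i | j)
  · simp [Subsingleton.elim i 0]
  · rfl

/-- Algebraicity over `C` and a tuple is witnessed by a family of finite sets of bounded size. -/
theorem mem_acl_union_range_iff {C : Set (MEq L M)} {ι : Type} {b : ι → M} {c : M} :
    c ∈ acl L (C ∪ Set.range fun i => home L (b i)) ↔
      ∃ W : Set (Fin 1 ⊕ ι → M), DefinableOver L C W ∧ Sum.elim (fun _ => c) b ∈ W ∧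
        ∃ N, BoundedFibers N W := by
  constructor
  · rintro ⟨X, hX, hc, hd⟩
    obtain ⟨Y, hY, hXY⟩ := definableOver_union_range_home.1 hd
    set N := X.ncard with hN
    let g : Fin 1 ⊕ ι → ((Fin 1 ⊕ ι) ⊕ Fin N) ⊕ Fin 1 :=
      Sum.elim (fun _ => Sum.inr 0) fun i => Sum.inl (Sum.inl (Sum.inr i))
    -- The first-order condition that the fibre has at most `N` elements, expressed by an `N`-tuple
    -- that lists them.
    let B : Set (Fin 1 ⊕ ι → M) := {w | ∃ z : Fin N → M, ∀ u : Fin 1 → M,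
      Sum.elim (Sum.elim w z) u ∈ {q | q ∘ g ∈ Y}ᶜ ∪
        ⋃ i : Fin N, {q | q (Sum.inr 0) = q (Sum.inl (Sum.inr i))}}
    have hB : DefinableOver L C B :=
      (((hY.preimage_comp g).compl.union (DefinableOver.iUnion_of_finite fun i =>
        definableOver_eq C _ _)).forall_of_finite).exists_of_finite
    have hBiff : ∀ w, w ∈ B ↔ ∃ z : Fin N → M,
        {y | Sum.elim (fun _ => y) (w ∘ Sum.inr) ∈ Y} ⊆ Set.range z := by
      intro w
      refine exists_congr fun z => ⟨fun h y hy => ?_, fun h u => ?_⟩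
      · rcases h (fun _ => y) with h1 | h1
        · refine absurd ?_ h1
          show _ ∈ Y
          rwa [show Sum.elim (Sum.elim w z) (fun _ => y) ∘ g =
            Sum.elim (fun _ => y) (w ∘ Sum.inr) by ext (i | j) <;> rfl]
        · obtain ⟨i, hi⟩ := Set.mem_iUnion.1 h1
          exact ⟨i, Eq.symm hi⟩
      · by_cases hu : u 0 ∈ Set.range z
        · obtain ⟨i, hi⟩ := hu
          exact Or.inr (Set.mem_iUnion.2 ⟨i, Eq.symm hi⟩)
        · refine Or.inl fun hY => hu (h ?_)
          show _ ∈ Y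
          change _ ∈ Y at hY
          rwa [show Sum.elim (fun _ => u 0) (w ∘ Sum.inr) =
            Sum.elim (Sum.elim w z) u ∘ g by ext (i | j) <;> rfl]
    refine ⟨Y ∩ B, hY.inter hB, ⟨(hXY fun _ => c).1 hc, (hBiff _).2 ?_⟩, N, fun v => ?_⟩
    · obtain ⟨e⟩ : Nonempty (Fin N ≃ X) := by
        have : Fintype X := hX.fintype
        exact ⟨(Fintype.equivFinOfCardEq (by rw [hN, ← Nat.card_coe_set_eq]; simp)).symm⟩
      refine ⟨fun i => e i, fun y hy => ?_⟩
      have hy' : y ∈ X := (hXY fun _ => y).2 hy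
      exact ⟨e.symm ⟨y, hy'⟩, by simp⟩
    · by_cases hne : {y : M | Sum.elim (fun _ => y) v ∈ Y ∩ B}.Nonempty
      · obtain ⟨y, hy⟩ := hne
        obtain ⟨z, hz⟩ := (hBiff _).1 hy.2
        have hsub : {y : M | Sum.elim (fun _ => y) v ∈ Y ∩ B} ⊆ Set.range z :=
          fun y' hy' => hz hy'.1
        refine ⟨(Set.finite_range z).subset hsub, ?_⟩
        refine (Set.ncard_le_ncard hsub (Set.finite_range z)).trans ?_
        rw [← Set.image_univ]
        exact (Set.ncard_image_le).trans (by simp)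
      · rw [Set.not_nonempty_iff_eq_empty] at hne
        rw [hne]
        simp
  · rintro ⟨W, hW, hc, N, hN⟩
    refine ⟨_, (hN b).1, hc, definableOver_union_range_home.2 ⟨W, hW, fun x => ?_⟩⟩
    rw [elim_fin_one]
    rfl

theorem mem_acl_of_bounded {C : Set (MEq L M)} {ι : Type} {b : ι → M} {c : M} {N : ℕ}
    {W : Set (Fin 1 ⊕ ι → M)} (hW : DefinableOver L C W) (hc : Sum.elim (fun _ => c) b ∈ W)
    (hN : BoundedFibers N W) : c ∈ acl L (C ∪ Set.range fun i => home L (b i)) :=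
  mem_acl_union_range_iff.2 ⟨W, hW, hc, N, hN⟩

theorem mem_acl_of_home_mem {C : Set (MEq L M)} {a : M} (h : home L a ∈ C) : a ∈ acl L C := by
  have h1 : a ∈ acl L (C ∪ Set.range fun _ : Fin 1 => home L a) :=
    mem_acl_of_bounded (b := fun _ : Fin 1 => a) (N := 1)
      (definableOver_eq C (Sum.inl 0) (Sum.inr 0)) rfl fun v => by simp
  exact acl_mono (Set.union_subset subset_rfl (by simpa using h)) h1

/-- Transitivity: let the tuple range over the finite product of the sets witnessing algebraicity of
its entries, and take the union of the finite fibres. -/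
theorem mem_acl_of_forall_mem_acl {C : Set (MEq L M)} {ι : Type} [Finite ι] {b : ι → M} {c : M}
    (hb : ∀ i, b i ∈ acl L C) (hc : c ∈ acl L (C ∪ Set.range fun i => home L (b i))) :
    c ∈ acl L C := by
  obtain ⟨W, hW, hcW, N, hN⟩ := mem_acl_union_range_iff.1 hc
  choose F hF hbF hFd using hb
  have hd : DefinableOver L C {x : Fin 1 → M | ∃ v : ι → M, Sum.elim x v ∈
      W ∩ ⋂ i, {w : Fin 1 ⊕ ι → M | w ∘ (fun _ : Fin 1 => Sum.inr i) ∈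
        {x : Fin 1 → M | x 0 ∈ F i}}} :=
    (hW.inter (DefinableOver.iInter_of_finite fun i =>
      (hFd i).preimage_comp _)).exists_of_finite
  refine ⟨{y | ∃ v ∈ Set.pi Set.univ F, Sum.elim (fun _ => y) v ∈ W}, ?_, ?_, ?_⟩
  · have : {y | ∃ v ∈ Set.pi Set.univ F, Sum.elim (fun _ => y) v ∈ W} =
        ⋃ v ∈ Set.pi Set.univ F, {y | Sum.elim (fun _ => y) v ∈ W} := by
      ext y; simp
    rw [this]
    exact (Set.Finite.pi hF).biUnion fun v _ => (hN v).1
  · exact ⟨b, fun i _ => hbF i, hcW⟩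
  · convert hd using 1
    ext x
    refine exists_congr fun v => ?_
    rw [Set.mem_inter_iff, elim_fin_one x v, and_comm]
    refine and_congr Iff.rfl ?_
    simp [Set.mem_pi]

/-- The closure operator on `M` given by algebraicity over `C`. -/
def aclOver (L : FirstOrder.Language.{u, v}) [L.Structure M] (C : Set (MEq L M)) (S : Set M) :
    Set M := acl L (C ∪ home L '' S)

theorem aclOver_mono (C : Set (MEq L M)) {S T : Set M} (h : S ⊆ T) :
    aclOver L C S ⊆ aclOver L C T :=
  acl_mono (Set.union_subset_union_right _ (Set.image_mono h))

theorem subset_aclOver (C : Set (MEq L M)) (S : Set M) : S ⊆ aclOver L C S :=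
  fun _ ha => mem_acl_of_home_mem (Or.inr ⟨_, ha, rfl⟩)

theorem aclOver_idem (C : Set (MEq L M)) {S T : Set M} (h : S ⊆ aclOver L C T) :
    aclOver L C S ⊆ aclOver L C T := by
  intro a ha
  obtain ⟨C₀, hC₀, hfin, ha⟩ := acl_exists_finite ha
  obtain ⟨n, f, hf⟩ := (hfin.subset (Set.inter_subset_left (t := home L '' S))).fin_embedding
  have hfS : ∀ i, ∃ b ∈ S, home L b = f i := fun i =>
    (hf.subset (Set.mem_range_self i)).2
  choose b hbS hb using hfS
  refine mem_acl_of_forall_mem_acl (fun i => h (hbS i)) (acl_mono (fun e he => ?_) ha)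
  rcases hC₀ he with heC | heS
  · exact Or.inl (Or.inl heC)
  · obtain ⟨i, hi⟩ : e ∈ Set.range f := hf ▸ ⟨he, heS⟩
    exact Or.inr ⟨i, (hb i).trans hi⟩

end Calculus

/-! ### Saturation, homogeneity and automorphisms fixing imaginaries. -/

section Automorphisms

variable {L : FirstOrder.Language.{u, v}} {M : Type w} [L.Structure M]

theorem IsSaturated.exists_mem_all {κ : Cardinal.{w}} (hs : IsSaturated L M κ) {A : Set M}
    (hA : Cardinal.mk A < κ) {α : Type*} [Finite α] (𝒮 : Set (Set (α → M)))
    (hdef : ∀ X ∈ 𝒮, A.Definable L X)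
    (hfip : ∀ 𝒮₀ ⊆ 𝒮, 𝒮₀.Finite → ∃ x, ∀ X ∈ 𝒮₀, x ∈ X) : ∃ x, ∀ X ∈ 𝒮, x ∈ X := by
  obtain ⟨n, ⟨e⟩⟩ := Finite.exists_equiv_fin α
  let T : L[[A]].Formula (Fin n) → Set (α → M) := fun φ => {x | φ.Realize (x ∘ e.symm)}
  obtain ⟨x, hx⟩ := hs A hA n {φ | T φ ∈ 𝒮} (by
    intro p₀ hp₀ hfin
    obtain ⟨x, hx⟩ := hfip (T '' p₀) (by rintro _ ⟨φ, hφ, rfl⟩; exact hp₀ hφ) (hfin.image T)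
    exact ⟨x ∘ e.symm, fun φ hφ => hx _ ⟨φ, hφ, rfl⟩⟩)
  refine ⟨x ∘ e, fun X hX => ?_⟩
  obtain ⟨ψ, hψ⟩ := hdef X hX
  have hT : T (ψ.relabel e) = X := by
    rw [hψ]
    ext y
    show Formula.Realize _ _ ↔ Formula.Realize _ _
    rw [Formula.realize_relabel]
    congr! 1
    ext i
    simp
  have := hx (ψ.relabel e) (by show T _ ∈ 𝒮; rwa [hT])
  rw [← hT]
  show Formula.Realize _ _
  convert this using 1
  ext i
  simp

theorem IsMonster.exists_equiv {κ : Cardinal.{w}} (hM : IsMonster L M κ) {P : Type*} [Finite P]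
    {v w : P → M} (h : ∀ φ : L.Formula P, φ.Realize v → φ.Realize w) :
    ∃ σ : M ≃[L] M, ∀ p, σ (v p) = w p := by
  have hiff : ∀ φ : L.Formula P, φ.Realize v ↔ φ.Realize w := fun φ =>
    ⟨h φ, fun hw => by_contra fun hv => h φ.not hv hw⟩
  choose q hq using fun a : Set.range v => a.2
  obtain ⟨σ, hσ⟩ := hM.homogeneous (Set.range v) (fun a => w (q a))
    ((Set.finite_range v).lt_aleph0.trans hM.aleph0_lt) fun n φ x => by
      have := hiff (φ.relabel fun i => q (x i))
      rw [Formula.realize_relabel, Formula.realize_relabel] at this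
      rwa [show v ∘ (fun i => q (x i)) = fun i => (x i : M) from funext fun i => hq (x i)] at this
  refine ⟨σ, fun p => ?_⟩
  rw [hσ ⟨v p, p, rfl⟩]
  have := hiff (Term.equal (Term.var (q ⟨v p, p, rfl⟩)) (Term.var p))
  simp only [Formula.realize_equal, Term.realize_var] at this
  exact this.1 (hq _)

theorem EqSort.rel_map (s : EqSort L M) (τ : M ≃[L] M) (y z : Fin s.arity → M) :
    s.rel (fun i => τ (y i)) (fun i => τ (z i)) ↔ s.rel y z := by
  obtain ⟨ρ, hρ⟩ := Set.empty_definable_iff.1 s.definable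
  have key : ∀ y z : Fin s.arity → M, s.rel y z ↔ ρ.Realize (Sum.elim y z) := fun y z =>
    Set.ext_iff.1 hρ (Sum.elim y z)
  rw [key, key, ← StrongHomClass.realize_formula τ ρ (v := Sum.elim y z)]
  congr! 1
  ext (i | i) <;> rfl

/-- The automorphisms of `M` that fix `C` pointwise, as permutations. -/
def autFixing (L : FirstOrder.Language.{u, v}) {M : Type w} [L.Structure M]
    (C : Set (MEq L M)) : Subgroup (Equiv.Perm M) where
  carrier := {σ | (∃ τ : M ≃[L] M, ∀ x, τ x = σ x) ∧ ∀ e ∈ C, ∀ y,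
    Quotient.mk e.srt.rel y = e.val → Quotient.mk e.srt.rel (fun i => σ (y i)) = e.val}
  one_mem' := ⟨⟨FirstOrder.Language.Equiv.refl L M, fun _ => rfl⟩, fun _ _ _ h => h⟩
  mul_mem' := by
    rintro σ σ' ⟨⟨τ, hτ⟩, h⟩ ⟨⟨τ', hτ'⟩, h'⟩
    exact ⟨⟨τ.comp τ', fun x => by simp [hτ, hτ']⟩, fun e he y hy => h e he _ (h' e he y hy)⟩
  inv_mem' := by
    rintro σ ⟨⟨τ, hτ⟩, h⟩
    refine ⟨⟨τ.symm, fun x => ?_⟩, fun e he y hy => ?_⟩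
    · rw [Equiv.Perm.eq_inv_iff_eq, ← hτ, FirstOrder.Language.Equiv.apply_symm_apply]
    · have h1 := h e he y hy
      rw [← hy, Quotient.eq] at h1 ⊢
      rw [← e.srt.rel_map τ]
      have h2 : (fun i => τ (σ⁻¹ (y i))) = y := funext fun i => by
        rw [hτ]; exact σ.apply_symm_apply _
      have h3 : (fun i => τ (y i)) = fun i => σ (y i) := funext fun i => hτ _
      rw [h2, h3]
      exact e.srt.rel.symm h1

theorem realize_of_mem_autFixing {C : Set (MEq L M)} {σ : Equiv.Perm M}
    (hσ : σ ∈ autFixing L C) {α : Type*} (φ : L.Formula α) (x : α → M) :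
    φ.Realize (fun i => σ (x i)) ↔ φ.Realize x := by
  obtain ⟨⟨τ, hτ⟩, -⟩ := hσ
  rw [← StrongHomClass.realize_formula τ φ (v := x)]
  simp only [← hτ]
  rfl

theorem DefinableOver.mem_iff_of_mem_autFixing {C : Set (MEq L M)} {α : Type} {X : Set (α → M)}
    (h : DefinableOver L C X) {σ : Equiv.Perm M} (hσ : σ ∈ autFixing L C) (x : α → M) :
    (fun i => σ (x i)) ∈ X ↔ x ∈ X := by
  rw [definableOver_iff] at h
  obtain ⟨φ, hφ⟩ := h
  obtain ⟨y, hy⟩ := exists_isRep C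
  rw [hφ y hy x, hφ (fun p => σ (y p)) (fun e => hσ.2 e.1 e.2 _ (hy e)),
    ← realize_of_mem_autFixing hσ φ (Sum.elim x y)]
  congr! 1
  ext (i | p) <;> rfl

/-- The orbit of `a` under the automorphisms fixing `C` is infinite if `a` is not algebraic over
the finite set `C`. -/
theorem IsMonster.infinite_orbit {κ : Cardinal.{w}} (hM : IsMonster L M κ) {C : Set (MEq L M)}
    (hC : C.Finite) {a : M} (ha : a ∉ acl L C) :
    (MulAction.orbit (autFixing L C) a).Infinite := by
  intro hO
  set O := MulAction.orbit (autFixing L C) a with hOdef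
  have : Finite C := hC
  obtain ⟨y, hy⟩ := exists_isRep C
  let v : Fin 1 ⊕ Params C → M := Sum.elim (fun _ => a) y
  -- If the orbit `O` is finite, it can be used as parameters: each `Z φ` asks for a realization of
  -- `φ` that represents the same imaginaries and has first coordinate off `O`.
  let Z : L.Formula (Fin 1 ⊕ Params C) → Set (Fin 1 ⊕ Params C → M) := fun φ =>
    {w | φ.Realize w ∧ IsRep C (w ∘ Sum.inr) ∧ w (Sum.inl 0) ∉ O}
  have hinf : ∀ φ : L.Formula (Fin 1 ⊕ Params C), φ.Realize v → (Z φ).Nonempty := by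
    intro φ hφ
    have hd := definableOver_exists_isRep φ
    set X : Set M := {x | ∃ z, IsRep C z ∧ φ.Realize (Sum.elim (fun _ => x) z)} with hX
    have hXinf : X.Infinite := by
      intro hfin
      refine ha ⟨X, hfin, ⟨y, hy, hφ⟩, ?_⟩
      convert hd using 1
      ext x
      refine exists_congr fun z => ?_
      rw [show x = fun _ => x 0 by ext i; rw [Subsingleton.elim i 0] ]
    obtain ⟨x, ⟨z, hz, hxz⟩, hxO⟩ := hXinf.exists_notMem_finite hO
    exact ⟨Sum.elim (fun _ => x) z, hxz, hz, hxO⟩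
  obtain ⟨w, hw⟩ := hM.saturated.exists_mem_all (A := Set.range y ∪ O)
    (((Set.finite_range y).union hO).lt_aleph0.trans hM.aleph0_lt) (Z '' {φ | φ.Realize v}) (by
      rintro _ ⟨φ, -, rfl⟩
      have h1 : (Set.range y ∪ O).Definable L {w : Fin 1 ⊕ Params C → M | φ.Realize w} := by
        rw [Set.definable_iff_exists_formula_sum]
        exact ⟨φ.relabel Sum.inr, by ext w; simp [Formula.realize_relabel]⟩
      have h2 : (Set.range y ∪ O).Definable L
          {w : Fin 1 ⊕ Params C → M | IsRep C (w ∘ Sum.inr)} := by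
        have : {w : Fin 1 ⊕ Params C → M | IsRep C (w ∘ Sum.inr)} =
            ⋂ e : C, {w | e.1.srt.rel (fun i => w (Sum.inr ⟨e, i⟩)) fun i => y ⟨e, i⟩} := by
          ext w
          rw [Set.mem_iInter]
          refine forall_congr' fun e => ?_
          rw [← hy e, Quotient.eq]
          rfl
        rw [this]
        refine Set.definable_iInter_of_finite fun e => ?_
        obtain ⟨ρ, hρ⟩ := Set.empty_definable_iff.1 e.1.srt.definable
        rw [Set.definable_iff_exists_formula_sum]
        refine ⟨ρ.relabel (Sum.elim (fun i => Sum.inr (Sum.inr ⟨e, i⟩))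
          fun i => Sum.inl ⟨y ⟨e, i⟩, Or.inl ⟨_, rfl⟩⟩), ?_⟩
        ext w
        rw [Set.mem_ofPred_eq, Set.mem_ofPred_eq, Formula.realize_relabel]
        exact Set.ext_iff.1 hρ (Sum.elim (fun i => w (Sum.inr ⟨e, i⟩)) fun i => y ⟨e, i⟩) |>.trans
          (by rw [Set.mem_ofPred_eq]; congr! 1; ext (i | i) <;> rfl)
      have h3 : (Set.range y ∪ O).Definable L
          {w : Fin 1 ⊕ Params C → M | w (Sum.inl 0) ∉ O} := by
        have : {w : Fin 1 ⊕ Params C → M | w (Sum.inl 0) ∉ O} =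
            (⋃ o : O, {w | w (Sum.inl 0) = o.1})ᶜ := by
          ext w
          simp only [Set.mem_compl_iff, Set.mem_iUnion, Subtype.exists, exists_prop]
          exact ⟨fun h ⟨o, ho, e⟩ => h (e ▸ ho), fun h hm => h ⟨_, hm, rfl⟩⟩
        rw [this]
        have : Finite O := hO
        refine (Set.definable_iUnion_of_finite fun o => ?_).compl
        exact (Set.DefinableFun.proj L).ofPred_eq_const (Or.inr o.2)
      exact h1.inter (h2.inter h3)) (by
      intro 𝒮₀ h𝒮₀ hfin
      obtain ⟨Φ, hΦ, hΦfin, rfl⟩ := hfin.exists_subset_finite_image_eq h𝒮₀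
      have : Finite Φ := hΦfin
      cases nonempty_fintype Φ
      obtain ⟨w, hw⟩ := hinf (Formula.iInf fun φ : Φ => φ.1)
        (by rw [Formula.realize_iInf]; exact fun φ => hΦ φ.2)
      refine ⟨w, ?_⟩
      rintro _ ⟨φ, hφ, rfl⟩
      exact ⟨Formula.realize_iInf.1 hw.1 ⟨φ, hφ⟩, hw.2⟩)
  have hw' : ∀ φ : L.Formula (Fin 1 ⊕ Params C), φ.Realize v → w ∈ Z φ :=
    fun φ hφ => hw _ ⟨φ, hφ, rfl⟩
  -- The automorphism sends representatives of `C` to representatives of the same elements, so it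
  -- fixes `C`, yet it moves `a` out of its own orbit.
  obtain ⟨τ, hτ⟩ := hM.exists_equiv fun φ hφ => (hw' φ hφ).1
  obtain ⟨-, hrep, hwO⟩ := hw' ⊤ (by simp)
  refine hwO ⟨⟨τ.toEquiv, ⟨τ, fun _ => rfl⟩, fun e he z hz => ?_⟩, hτ (Sum.inl 0)⟩
  rw [← hrep ⟨e, he⟩, Quotient.eq]
  have h1 : e.srt.rel z fun i => y ⟨⟨e, he⟩, i⟩ := by
    rw [← Quotient.eq, hz]; exact (hy ⟨e, he⟩).symm
  have h2 := (e.srt.rel_map τ _ _).2 h1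
  have h3 : (fun i => w (Sum.inr ⟨⟨e, he⟩, i⟩)) = fun i => τ (y ⟨⟨e, he⟩, i⟩) :=
    funext fun i => (hτ _).symm
  show e.srt.rel (fun i => τ (z i)) fun i => w (Sum.inr ⟨⟨e, he⟩, i⟩)
  rwa [h3]

end Automorphisms

/-! ### Interiors in a definable topology. -/

section Topological

variable {L : FirstOrder.Language.{u, v}} {M : Type w} [L.Structure M]

theorem definable_exists {A : Set M} {α β : Type*} [Finite β] {P : (α → M) → (β → M) → Prop}
    (h : A.Definable L {w : α ⊕ β → M | P (w ∘ Sum.inl) (w ∘ Sum.inr)}) :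
    A.Definable L {v : α → M | ∃ u, P v u} :=
  h.exists_of_finite

theorem definable_forall {A : Set M} {α β : Type*} [Finite β] {P : (α → M) → (β → M) → Prop}
    (h : A.Definable L {w : α ⊕ β → M | P (w ∘ Sum.inl) (w ∘ Sum.inr)}) :
    A.Definable L {v : α → M | ∀ u, P v u} :=
  h.forall_of_finite

theorem definable_imp {A : Set M} {α : Type*} {P Q : (α → M) → Prop}
    (hP : A.Definable L {v : α → M | P v}) (hQ : A.Definable L {v : α → M | Q v}) :
    A.Definable L {v : α → M | P v → Q v} := by
  convert hP.compl.union hQ using 1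
  ext v
  simp [imp_iff_not_or]

/-- The interior operator of the topology generated by the sets `{y | β(s, e, y)}`. -/
def intAt {l m : ℕ} (β : L.Formula ((Fin l ⊕ Fin m) ⊕ Fin 1)) (s : Fin l → M) (V : Set M) :
    Set M :=
  {y | ∃ e : Fin m → M, β.Realize (Sum.elim (Sum.elim s e) fun _ => y) ∧
    ∀ z : Fin 1 → M, β.Realize (Sum.elim (Sum.elim s e) z) → z 0 ∈ V}

/-- Isolates the parameters `t` of the topology, so that the interior operator can be moved by
automorphisms that do not fix `t`. -/
theorem exists_interior_eq_intAt [TopologicalSpace M] (h : IsDefinableTopology L M) :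
    ∃ (l m : ℕ) (t : Fin l → M) (β : L.Formula ((Fin l ⊕ Fin m) ⊕ Fin 1)),
      ∀ V : Set M, interior V = intAt β t V := by
  classical
  obtain ⟨m, D, B, -, hB, hbasis⟩ := h
  obtain ⟨A, -, hA⟩ := Set.definable_iff_finitely_definable.1 hB
  obtain ⟨φ, hφ⟩ := Set.definable_iff_exists_formula_sum.1 hA
  have hφ' : ∀ (y : M) (e : Fin m → M), (e ∈ D ∧ y ∈ B e) ↔
      φ.Realize (Sum.elim (↑) (Sum.elim (fun _ => y) e)) := fun y e =>
    Set.ext_iff.1 hφ (Sum.elim (fun _ => y) e)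
  let enum := A.equivFin
  let β : L.Formula ((Fin A.card ⊕ Fin m) ⊕ Fin 1) := φ.relabel
    (Sum.elim (fun a => Sum.inl (Sum.inl (enum a)))
      (Sum.elim Sum.inr fun j => Sum.inl (Sum.inr j)))
  let t : Fin A.card → M := fun i => enum.symm i
  have hβ : ∀ (y : M) (e : Fin m → M),
      β.Realize (Sum.elim (Sum.elim t e) fun _ => y) ↔ e ∈ D ∧ y ∈ B e := by
    intro y e
    rw [hφ', Formula.realize_relabel]
    congr! 1
    ext (a | i | j)
    · simp [t]
    · rfl
    · rfl
  refine ⟨A.card, m, t, β, fun V => ?_⟩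
  ext y
  rw [mem_interior_iff_mem_nhds, hbasis.mem_nhds_iff]
  constructor
  · rintro ⟨_, ⟨e, he, rfl⟩, hy, hsub⟩
    refine ⟨e, (hβ y e).2 ⟨he, hy⟩, fun z hz => hsub ?_⟩
    rw [show z = fun _ => z 0 from funext fun i => by rw [Subsingleton.elim i 0], hβ] at hz
    exact hz.2
  · rintro ⟨e, he, hsub⟩
    rw [hβ] at he
    exact ⟨B e, ⟨e, he.1, rfl⟩, he.2, fun z hz => hsub (fun _ => z) ((hβ z e).2 ⟨he.1, hz⟩)⟩

theorem definable_intAt {A : Set M} {l m : ℕ} (β : L.Formula ((Fin l ⊕ Fin m) ⊕ Fin 1))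
    {α : Type*} {V : (α → M) → Set M}
    (hV : A.Definable L {w : α ⊕ Fin 1 → M | w (Sum.inr 0) ∈ V (w ∘ Sum.inl)})
    {s : (α → M) → Fin l → M} (hs : A.DefinableMap L s)
    {f : (α → M) → M} (hf : A.DefinableFun L f) :
    A.Definable L {v : α → M | f v ∈ intAt β (s v) (V v)} := by
  have hβ : A.Definable L {w : (Fin l ⊕ Fin m) ⊕ Fin 1 → M | β.Realize w} :=
    Set.Definable.mono (Set.empty_definable_iff.2 ⟨β, rfl⟩) (Set.empty_subset A)
  refine definable_exists (Set.Definable.inter ?_ (definable_forall (definable_imp ?_ ?_)))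
  · refine hβ.preimage_map (F := fun w : α ⊕ Fin m → M => Sum.elim (Sum.elim (s (w ∘ Sum.inl))
      (w ∘ Sum.inr)) fun _ => f (w ∘ Sum.inl)) ?_
    rintro ((i | j) | k)
    · exact (hs i).preimage_comp (Option.map Sum.inl)
    · exact Set.DefinableFun.proj L
    · exact hf.preimage_comp (Option.map Sum.inl)
  · refine hβ.preimage_map (F := fun w : (α ⊕ Fin m) ⊕ Fin 1 → M =>
      Sum.elim (Sum.elim (s ((w ∘ Sum.inl) ∘ Sum.inl)) ((w ∘ Sum.inl) ∘ Sum.inr)) (w ∘ Sum.inr)) ?_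
    rintro ((i | j) | k)
    · exact (hs i).preimage_comp (Option.map (Sum.inl ∘ Sum.inl))
    · exact Set.DefinableFun.proj L
    · exact Set.DefinableFun.proj L
  · exact hV.preimage_comp (Sum.elim (Sum.inl ∘ Sum.inl) Sum.inr)

/-- Transport of structure: moving the parameters and the set by `σ` moves the interior by `σ`. -/
theorem mem_intAt_iff_of_mem_autFixing {C : Set (MEq L M)} {σ : Equiv.Perm M}
    (hσ : σ ∈ autFixing L C) {l m : ℕ} (β : L.Formula ((Fin l ⊕ Fin m) ⊕ Fin 1))
    (s : Fin l → M) (V : Set M) (y : M) :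
    σ y ∈ intAt β (fun i => σ (s i)) V ↔ y ∈ intAt β s (σ ⁻¹' V) := by
  have key : ∀ (e : Fin m → M) (z : Fin 1 → M),
      β.Realize (Sum.elim (Sum.elim (fun i => σ (s i)) fun i => σ (e i)) fun i => σ (z i)) ↔
        β.Realize (Sum.elim (Sum.elim s e) z) := by
    intro e z
    rw [← realize_of_mem_autFixing hσ β (Sum.elim (Sum.elim s e) z)]
    congr! 1
    ext ((i | i) | i) <;> rfl
  constructor
  · rintro ⟨e, he, h⟩
    have hee : (fun i => σ (σ.symm (e i))) = e := funext fun i => σ.apply_symm_apply _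
    refine ⟨fun i => σ.symm (e i), ?_, fun z hz => ?_⟩
    · rw [← key, hee]; exact he
    · rw [← key, hee] at hz
      exact h _ hz
  · rintro ⟨e, he, h⟩
    refine ⟨fun i => σ (e i), (key e fun _ => y).2 he, fun z hz => ?_⟩
    have hzz : (fun i => σ (σ.symm (z i))) = z := funext fun i => σ.apply_symm_apply _
    rw [← hzz, key] at hz
    simpa using h _ hz

variable [TopologicalSpace M]

/-- The open set itself need not be definable, but it contains a non-empty basic one, which is. -/
theorem IsTMinimal.infinite_of_isOpen (ht : IsTMinimal L M) {U : Set M} (hU : IsOpen U)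
    (hne : U.Nonempty) : U.Infinite := by
  obtain ⟨m, D, B, -, hB, hbasis⟩ := ht.definable
  obtain ⟨y, hy⟩ := hne
  obtain ⟨_, ⟨e, he, rfl⟩, hye, hsub⟩ := hbasis.exists_subset_of_mem_open hy hU
  refine Set.Infinite.mono hsub ((ht.interior_nonempty_iff (B e) ?_).1
    ⟨y, by rwa [(hbasis.isOpen ⟨e, he, rfl⟩).interior_eq]⟩)
  have := hB.preimage_map (F := fun x : Fin 1 → M => Sum.elim x e) (by
    rintro (i | j)
    · exact Set.DefinableFun.proj L
    · exact L.definableFun_const _ (Set.mem_univ _))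
  show (Set.univ : Set M).Definable L {x : Fin 1 → M | x 0 ∈ B e}
  convert this using 1
  ext x
  exact (and_iff_right he).symm

theorem IsTMinimal.definable_interior (ht : IsTMinimal L M) {α : Type*} {V : (α → M) → Set M}
    (hV : (Set.univ : Set M).Definable L {w : α ⊕ Fin 1 → M | w (Sum.inr 0) ∈ V (w ∘ Sum.inl)})
    {f : (α → M) → M} (hf : (Set.univ : Set M).DefinableFun L f) :
    (Set.univ : Set M).Definable L {v : α → M | f v ∈ interior (V v)} := by
  obtain ⟨l, m, t, β, h⟩ := exists_interior_eq_intAt ht.definable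
  simp only [h]
  exact definable_intAt β hV (s := fun _ => t)
    (fun i => L.definableFun_const _ (Set.mem_univ _)) hf

/-- The difference is definable and has empty interior. -/
theorem IsTMinimal.finite_diff_interior (ht : IsTMinimal L M) {V : Set M}
    (hV : (Set.univ : Set M).Definable₁ L V) : (V \ interior V).Finite := by
  by_contra hinf
  have hint : (Set.univ : Set M).Definable₁ L (interior V) :=
    ht.definable_interior (α := Fin 1) (V := fun _ => V)
      (hV.preimage_comp (fun _ : Fin 1 => (Sum.inr 0 : Fin 1 ⊕ Fin 1))) (Set.DefinableFun.proj L)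
  obtain ⟨y, hy⟩ := (ht.interior_nonempty_iff (V \ interior V) (hV.sdiff hint)).2 hinf
  exact (interior_subset hy).2 (interior_mono Set.sdiff_subset hy)

/-- Finite sets in a definable family are bounded in size. -/
theorem IsTMinimal.exists_ncard_le {κ : Cardinal.{w}} (hM : IsMonster L M κ)
    (ht : IsTMinimal L M) {l : ℕ} {Y : (Fin l → M) → Set M}
    (hY : (Set.univ : Set M).Definable L
      {w : Fin l ⊕ Fin 1 → M | w (Sum.inr 0) ∈ Y (w ∘ Sum.inl)}) :
    ∃ K : ℕ, ∀ s, (Y s).Finite → (Y s).ncard ≤ K := by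
  by_contra! hcon
  obtain ⟨k, m, t, β, hβ⟩ := exists_interior_eq_intAt ht.definable
  obtain ⟨A₀, -, hA₀⟩ := Set.definable_iff_finitely_definable.1 hY
  set A : Set M := A₀ ∪ Set.range t with hA
  have hYA : A.Definable L {w : Fin l ⊕ Fin 1 → M | w (Sum.inr 0) ∈ Y (w ∘ Sum.inl)} :=
    hA₀.mono Set.subset_union_left
  -- Members of the family with empty interior but at least `n` elements, for every `n`, would by
  -- saturation yield an infinite member with empty interior. The parameters include `t` so that `I`
  -- is definable over them.
  let I : Set (Fin l → M) := {s | ∀ y : Fin 1 → M, ¬ y 0 ∈ interior (Y s)}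
  let T : ℕ → Set (Fin l → M) := fun n => {s | ∃ z : Fin n → M, (∀ i, z i ∈ Y s) ∧
    ∀ i j, i ≠ j → z i ≠ z j}
  obtain ⟨s, hs⟩ := hM.saturated.exists_mem_all (A := A)
    ((A₀.finite_toSet.union (Set.finite_range t)).lt_aleph0.trans hM.aleph0_lt)
    (insert I (Set.range T)) (by
      rintro _ (rfl | ⟨n, rfl⟩)
      · refine definable_forall (Set.Definable.compl ?_)
        simp only [hβ]
        exact definable_intAt β (V := fun w : Fin l ⊕ Fin 1 → M => Y (w ∘ Sum.inl))
          (hYA.preimage_comp (Sum.elim (Sum.inl ∘ Sum.inl) Sum.inr)) (s := fun _ => t)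
          (fun i => L.definableFun_const _ (Or.inr ⟨i, rfl⟩)) (Set.DefinableFun.proj L)
      · have h1 : A.Definable L {w : Fin l ⊕ Fin n → M |
            ∀ i, w (Sum.inr i) ∈ Y (w ∘ Sum.inl)} := by
          rw [Set.ofPred_forall]
          exact Set.definable_iInter_of_finite fun i => hYA.preimage_comp
            (Sum.elim Sum.inl fun _ => Sum.inr i : Fin l ⊕ Fin 1 → Fin l ⊕ Fin n)
        have h2 : A.Definable L {w : Fin l ⊕ Fin n → M |
            ∀ i j, i ≠ j → w (Sum.inr i) ≠ w (Sum.inr j)} := by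
          rw [Set.ofPred_forall]
          refine Set.definable_iInter_of_finite fun i => ?_
          rw [Set.ofPred_forall]
          refine Set.definable_iInter_of_finite fun j => ?_
          by_cases hij : i = j
          · simp [hij]
          · simp only [ne_eq, hij, not_false_eq_true, true_imp_iff]
            exact (Set.DefinableFun.ofPred_eq (Set.DefinableFun.proj L)
              (Set.DefinableFun.proj L)).compl
        exact definable_exists (h1.inter h2)) (by
      intro 𝒮₀ h𝒮₀ hfin
      have hsub : 𝒮₀ \ {I} ⊆ T '' Set.univ := by
        rintro X ⟨hX, hXI⟩
        rw [Set.image_univ]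
        exact (h𝒮₀ hX).resolve_left hXI
      obtain ⟨N, -, hN, hN'⟩ := (hfin.subset Set.sdiff_subset).exists_subset_finite_image_eq hsub
      obtain ⟨n, hn⟩ := hN.bddAbove
      obtain ⟨s, hsfin, hs⟩ := hcon n
      refine ⟨s, fun X hX => ?_⟩
      by_cases hXI : X = I
      · subst hXI
        intro y hy
        have hd : (Set.univ : Set M).Definable₁ L (Y s) := by
          have := hY.preimage_map (F := fun x : Fin 1 → M => Sum.elim s x) (by
            rintro (i | j)
            · exact L.definableFun_const _ (Set.mem_univ _)
            · exact Set.DefinableFun.proj L)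
          exact this
        exact (ht.interior_nonempty_iff _ hd).1 ⟨_, hy⟩ hsfin
      · obtain ⟨i, hi, rfl⟩ : X ∈ T '' N := hN' ▸ ⟨hX, hXI⟩
        have : Fintype (Y s) := hsfin.fintype
        have hcard : i ≤ Fintype.card (Y s) := by
          rw [← Nat.card_eq_fintype_card, Nat.card_coe_set_eq]
          exact (hn hi).trans hs.le
        let e := (Fintype.equivFin (Y s)).symm
        refine ⟨fun j => e (Fin.castLE hcard j), fun j => (e _).2, fun j k hjk h => hjk ?_⟩
        exact Fin.castLE_injective hcard (e.injective (Subtype.ext h)))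
  have hinf : (Y s).Infinite := by
    intro hfin
    obtain ⟨z, hz, hinj⟩ := hs (T ((Y s).ncard + 1)) (Or.inr ⟨_, rfl⟩)
    have hinj' : Function.Injective z := fun i j h => by_contra fun hij => hinj i j hij h
    have h1 : (Set.range z).ncard ≤ (Y s).ncard :=
      Set.ncard_le_ncard (Set.range_subset_iff.2 hz) hfin
    rw [← Set.image_univ, Set.ncard_image_of_injective _ hinj', Set.ncard_univ] at h1
    simp at h1
  have hd : (Set.univ : Set M).Definable₁ L (Y s) :=
    hY.preimage_map (F := fun x : Fin 1 → M => Sum.elim s x) (by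
      rintro (i | j)
      · exact L.definableFun_const _ (Set.mem_univ _)
      · exact Set.DefinableFun.proj L)
  obtain ⟨y, hy⟩ := (ht.interior_nonempty_iff _ hd).2 hinf
  exact hs I (Or.inl rfl) (fun _ => y) hy

end Topological

/-! ### Point-finite families and counting along fibres. -/

/-- Membership of a point in the interiors of the members of a point-finite family is constant on
some non-empty open subset of any given non-empty open set. -/
theorem exists_isOpen_forall_mem_interior_iff {M : Type*} [TopologicalSpace M] {V : M → Set M}
    {N : ℕ} (hV : ∀ y, {x | y ∈ V x}.Finite ∧ {x | y ∈ V x}.ncard ≤ N) {U : Set M}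
    (hU : IsOpen U) (hne : U.Nonempty) :
    ∃ O ⊆ U, IsOpen O ∧ ∃ y₀ ∈ O, ∀ y ∈ O, ∀ x, y ∈ interior (V x) ↔ y₀ ∈ interior (V x) := by
  have hsub : ∀ y, {x | y ∈ interior (V x)} ⊆ {x | y ∈ V x} :=
    fun y x hx => interior_subset (s := V x) hx
  have hfin : ∀ y, {x | y ∈ interior (V x)}.Finite := fun y => (hV y).1.subset (hsub y)
  have hbdd : BddAbove ((fun y => {x | y ∈ interior (V x)}.ncard) '' U) :=
    ⟨N, by
      rintro _ ⟨y, -, rfl⟩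
      exact (Set.ncard_le_ncard (hsub y) (hV y).1).trans (hV y).2⟩
  -- Near a point lying in the largest number of interiors, no interior can be lost because they are
  -- open, and none gained by maximality.
  obtain ⟨y₀, hy₀, hmax⟩ := Nat.sSup_mem (hne.image _) hbdd
  refine ⟨U ∩ ⋂ x ∈ {x | y₀ ∈ interior (V x)}, interior (V x), Set.inter_subset_left,
    hU.inter ((hfin y₀).isOpen_biInter fun _ _ => isOpen_interior), y₀,
    ⟨hy₀, Set.mem_iInter₂.2 fun _ h => h⟩, fun y hy x => ?_⟩
  have hle : {x | y₀ ∈ interior (V x)} ⊆ {x | y ∈ interior (V x)} :=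
    fun x hx => Set.mem_iInter₂.1 hy.2 x hx
  have heq := Set.eq_of_subset_of_ncard_le hle
    ((le_csSup hbdd ⟨y, hy.1, rfl⟩).trans hmax.symm.le) (hfin y)
  exact (Set.ext_iff.1 heq x).symm

/-- Turns a bound on the exceptional points `y` into a bound on the exceptional pairs `(x, y)`. -/
theorem finite_and_ncard_le_of_fibers {α β : Type*} {S : Set (α × β)} {Y : Set β} {N K : ℕ}
    (hY : Y.Finite) (hK : Y.ncard ≤ K) (hSY : ∀ p ∈ S, p.2 ∈ Y)
    {R : β → Set α} (hSR : ∀ p ∈ S, p.1 ∈ R p.2) (hR : ∀ y, (R y).Finite ∧ (R y).ncard ≤ N) :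
    S.Finite ∧ S.ncard ≤ N * K := by
  classical
  have hS : S.Finite := by
    refine ((hY.biUnion fun y _ => (hR y).1).prod hY).subset fun p hp => ⟨?_, hSY p hp⟩
    exact Set.mem_biUnion (hSY p hp) (hSR p hp)
  refine ⟨hS, ?_⟩
  rw [Set.ncard_eq_toFinset_card _ hS]
  refine (Finset.card_le_mul_card_image_of_maps_to (t := hY.toFinset) (f := Prod.snd) (by
    simpa using fun a b h => hSY (a, b) h) N fun y _ => ?_).trans ?_
  · refine le_trans ?_ (hR y).2
    rw [Set.ncard_eq_toFinset_card _ (hR y).1]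
    refine Finset.card_le_card_of_injOn Prod.fst ?_ ?_
    · rintro p hp
      simp only [Finset.coe_filter, Set.Finite.mem_toFinset, Set.mem_ofPred_eq] at hp
      simpa [← hp.2] using hSR p hp.1
    · rintro p hp q hq h
      simp only [Finset.coe_filter, Set.Finite.mem_toFinset, Set.mem_ofPred_eq] at hp hq
      exact Prod.ext h (hp.2.trans hq.2.symm)
  · rw [← Set.ncard_eq_toFinset_card _ hY]
    exact Nat.mul_le_mul_left _ hK

/-! ### No element is interalgebraic with an independent pair. -/

section Pairs

variable {L : FirstOrder.Language.{u, v}} {M : Type w} [L.Structure M]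

/-- The set of all `y` with `(x, y) ∈ W`. -/
def fib (W : Set (Fin 1 ⊕ Fin 1 → M)) (x : M) : Set M :=
  {y | Sum.elim (fun _ => x) (fun _ => y) ∈ W}

theorem BoundedFibers.fib {W : Set (Fin 1 ⊕ Fin 1 → M)} {N : ℕ} (h : BoundedFibers N W) (y : M) :
    {x | y ∈ fib W x}.Finite ∧ {x | y ∈ fib W x}.ncard ≤ N := h fun _ => y

theorem DefinableOver.mem_fib_iff {C : Set (MEq L M)} {W : Set (Fin 1 ⊕ Fin 1 → M)}
    (hW : DefinableOver L C W) {σ : Equiv.Perm M} (hσ : σ ∈ autFixing L C) (x y : M) :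
    σ y ∈ fib W (σ x) ↔ y ∈ fib W x := by
  rw [fib, fib, Set.mem_ofPred_eq, Set.mem_ofPred_eq,
    ← hW.mem_iff_of_mem_autFixing hσ (Sum.elim (fun _ => x) fun _ => y)]
  congr! 1
  ext (i | i) <;> rfl

theorem DefinableOver.preimage_fib {C : Set (MEq L M)} {W : Set (Fin 1 ⊕ Fin 1 → M)}
    (hW : DefinableOver L C W) {σ : Equiv.Perm M} (hσ : σ ∈ autFixing L C) (x : M) :
    σ ⁻¹' fib W x = fib W (σ.symm x) :=
  Set.ext fun y => by
    rw [← hW.mem_fib_iff hσ (σ.symm x) y, σ.apply_symm_apply]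
    rfl

theorem definable_fib {A : Set M} {W : Set (Fin 1 ⊕ Fin 1 → M)} (hW : A.Definable L W)
    {α : Type*} (i j : α) : A.Definable L {w : α → M | w i ∈ fib W (w j)} := by
  convert hW.preimage_comp (Sum.elim (fun _ => j) fun _ => i) using 1
  ext w
  show Sum.elim _ _ ∈ W ↔ _ ∈ W
  congr! 1
  ext (i | i) <;> rfl

theorem definable₁_fib {W : Set (Fin 1 ⊕ Fin 1 → M)} (hW : (Set.univ : Set M).Definable L W)
    (x : M) : (Set.univ : Set M).Definable₁ L (fib W x) := by
  have := hW.preimage_map (F := fun y : Fin 1 → M => Sum.elim (fun _ => x) y) (by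
    rintro (i | j)
    · exact L.definableFun_const _ (Set.mem_univ _)
    · exact Set.DefinableFun.proj L)
  show (Set.univ : Set M).Definable L {y : Fin 1 → M | y 0 ∈ fib W x}
  convert this using 1
  ext y
  show Sum.elim _ _ ∈ W ↔ Sum.elim _ _ ∈ W
  congr! 1
  ext (i | i)
  · rfl
  · simp [Subsingleton.elim i 0]

theorem acl_union_exists_finite {C S : Set (MEq L M)} {a : M}
    (h : a ∈ acl L (C ∪ S)) : ∃ C₀ ⊆ C, C₀.Finite ∧ a ∈ acl L (C₀ ∪ S) := by
  obtain ⟨C₁, hC₁, hfin, ha⟩ := acl_exists_finite h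
  exact ⟨C₁ ∩ C, Set.inter_subset_right, hfin.subset Set.inter_subset_left,
    acl_mono (fun e he => (hC₁ he).imp (fun h => ⟨he, h⟩) id) ha⟩

variable [TopologicalSpace M]

/-- The points at which the interiors of some `fib W x` for the topology with parameters `t` and for
its translate under an automorphism fixing `C` differ form a finite set of bounded size. -/
theorem IsTMinimal.exists_interior_change_bound {κ : Cardinal.{w}} (hM : IsMonster L M κ)
    (ht : IsTMinimal L M) {C : Set (MEq L M)} {W : Set (Fin 1 ⊕ Fin 1 → M)}
    (hW : DefinableOver L C W) {N : ℕ} (hN : BoundedFibers N W) {l m : ℕ} {t : Fin l → M}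
    {β : L.Formula ((Fin l ⊕ Fin m) ⊕ Fin 1)} (hβ : ∀ V : Set M, interior V = intAt β t V) :
    ∃ K : ℕ, ∀ σ ∈ autFixing L C,
      {y | ∃ x, y ∈ interior (fib W x) ∧ y ∉ intAt β (fun i => σ (t i)) (fib W x)}.Finite ∧
      {y | ∃ x, y ∈ interior (fib W x) ∧ y ∉ intAt β (fun i => σ (t i)) (fib W x)}.ncard ≤ K := by
  have hWd := hW.definable_univ
  -- Letting the parameters `s` of the topology vary puts all translates in one definable family, so
  -- finiteness of each gives a common bound.
  let Y : (Fin l → M) → Set M := fun s =>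
    {y | ∃ x, y ∈ interior (fib W x) ∧ y ∉ intAt β s (fib W x)}
  have hY : (Set.univ : Set M).Definable L
      {w : Fin l ⊕ Fin 1 → M | w (Sum.inr 0) ∈ Y (w ∘ Sum.inl)} := by
    have h1 : (Set.univ : Set M).Definable L {w : (Fin l ⊕ Fin 1) ⊕ Fin 1 → M |
        w (Sum.inl (Sum.inr 0)) ∈ interior (fib W (w (Sum.inr 0)))} :=
      ht.definable_interior (V := fun w : (Fin l ⊕ Fin 1) ⊕ Fin 1 → M => fib W (w (Sum.inr 0)))
        (definable_fib hWd (Sum.inr 0) (Sum.inl (Sum.inr 0))) (Set.DefinableFun.proj L)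
    have h2 : (Set.univ : Set M).Definable L {w : (Fin l ⊕ Fin 1) ⊕ Fin 1 → M |
        w (Sum.inl (Sum.inr 0)) ∈
          intAt β (fun i => w (Sum.inl (Sum.inl i))) (fib W (w (Sum.inr 0)))} :=
      definable_intAt β (V := fun w : (Fin l ⊕ Fin 1) ⊕ Fin 1 → M => fib W (w (Sum.inr 0)))
        (definable_fib hWd (Sum.inr 0) (Sum.inl (Sum.inr 0)))
        (s := fun w i => w (Sum.inl (Sum.inl i)))
        (fun i => Set.DefinableFun.proj L) (Set.DefinableFun.proj L)
    convert definable_exists (P := fun (w : Fin l ⊕ Fin 1 → M) (u : Fin 1 → M) =>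
      w (Sum.inr 0) ∈ interior (fib W (u 0)) ∧
        w (Sum.inr 0) ∉ intAt β (w ∘ Sum.inl) (fib W (u 0))) (h1.inter h2.compl) using 1
    ext w
    exact ⟨fun ⟨x, hx⟩ => ⟨fun _ => x, hx⟩, fun ⟨u, hu⟩ => ⟨u 0, hu⟩⟩
  obtain ⟨K, hK⟩ := ht.exists_ncard_le hM hY
  refine ⟨K, fun σ hσ => ?_⟩
  suffices hfin : (Y fun i => σ (t i)).Finite from ⟨hfin, hK _ hfin⟩
  by_contra hinf
  have hYd : (Set.univ : Set M).Definable₁ L (Y fun i => σ (t i)) :=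
    hY.preimage_map (F := fun x : Fin 1 → M => Sum.elim (fun i => σ (t i)) x) (by
      rintro (i | j)
      · exact L.definableFun_const _ (Set.mem_univ _)
      · exact Set.DefinableFun.proj L)
  obtain ⟨O, hOU, hO, y₀, hy₀, hconst⟩ := exists_isOpen_forall_mem_interior_iff hN.fib
    isOpen_interior ((ht.interior_nonempty_iff _ hYd).2 hinf)
  refine ht.infinite_of_isOpen hO ⟨y₀, hy₀⟩ ?_
  -- On `O` only the finitely many `x` whose fibre contains `y₀` matter. For each, the difference is
  -- the `σ`-image of a fibre minus its interior, hence finite.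
  have hsub : O ⊆ ⋃ x ∈ {x | y₀ ∈ fib W x}, (fib W x \ intAt β (fun i => σ (t i)) (fib W x)) := by
    intro y hy
    obtain ⟨x, hx, hx'⟩ := interior_subset (hOU hy)
    exact Set.mem_biUnion (interior_subset (s := fib W x) ((hconst y hy x).1 hx))
      ⟨interior_subset hx, hx'⟩
  refine ((hN.fib y₀).1.biUnion fun x _ => ?_).subset hsub
  refine ((ht.finite_diff_interior (definable₁_fib hWd (σ.symm x))).image σ).subset ?_
  rintro y ⟨hy, hy'⟩
  refine ⟨σ.symm y, ?_, σ.apply_symm_apply y⟩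
  have h1 : σ ⁻¹' fib W x = fib W (σ.symm x) := hW.preimage_fib hσ x
  have h2 := mem_intAt_iff_of_mem_autFixing hσ β t (fib W x) (σ.symm y)
  rw [σ.apply_symm_apply, h1, ← hβ] at h2
  refine ⟨?_, fun h => hy' (h2.2 h)⟩
  rwa [← h1, Set.mem_preimage, σ.apply_symm_apply]

/-- If `a` is algebraic over `b` but not conversely, then for almost all conjugates `(a', b')` of
`(a, b)` the point `b'` is interior to the fibre over `a'`. -/
theorem IsTMinimal.mem_interior_fib_of_conj {κ : Cardinal.{w}} (hM : IsMonster L M κ)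
    (ht : IsTMinimal L M) {C : Set (MEq L M)} (hC : C.Finite) {W : Set (Fin 1 ⊕ Fin 1 → M)}
    (hW : DefinableOver L C W) {N : ℕ} (hN : BoundedFibers N W) {a b : M} (hab : b ∈ fib W a)
    (hb : b ∉ acl L (C ∪ {home L a})) :
    ∃ F : Set M, F.Finite ∧ ∀ σ ∈ autFixing L C, σ b ∉ F → σ b ∈ interior (fib W (σ a)) := by
  obtain ⟨l, m, t, β, hβ⟩ := exists_interior_eq_intAt ht.definable
  obtain ⟨K, hK⟩ := ht.exists_interior_change_bound hM hW hN hβ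
  let E : Set (M × M) := {p | p.2 ∈ fib W p.1 ∧ p.2 ∉ interior (fib W p.1)}
  obtain ⟨f, hfin, hf⟩ := exists_almost_invariant (G := autFixing L C) E (N * K) (by
    rintro ⟨σ, hσ⟩
    refine finite_and_ncard_le_of_fibers (hK σ hσ).1 (hK σ hσ).2 ?_
      (R := fun y => {x | y ∈ fib W x}) ?_ hN.fib
    · rintro ⟨x, y⟩ ⟨h1, h2⟩
      change σ.symm y ∈ fib W (σ.symm x) ∧ σ.symm y ∉ interior (fib W (σ.symm x)) at h1
      have h3 : y ∈ fib W x := by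
        have := (hW.mem_fib_iff hσ _ _).2 h1.1
        rwa [σ.apply_symm_apply, σ.apply_symm_apply] at this
      have h4 := mem_intAt_iff_of_mem_autFixing hσ β t (fib W x) (σ.symm y)
      rw [σ.apply_symm_apply, ← hβ, hW.preimage_fib hσ] at h4
      refine ⟨x, ?_, fun h => h1.2 (h4.1 h)⟩
      by_contra h
      exact h2 ⟨h3, h⟩
    · rintro ⟨x, y⟩ ⟨h1, -⟩
      change σ.symm y ∈ fib W (σ.symm x) ∧ σ.symm y ∉ interior (fib W (σ.symm x)) at h1
      have := (hW.mem_fib_iff hσ _ _).2 h1.1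
      rwa [σ.apply_symm_apply, σ.apply_symm_apply] at this) (ε := 1 / 3) (by norm_num)
  -- There are infinitely many conjugates of `b` over `C` and `a`, so one of them is interior to the
  -- fibre over `a` and avoids the finitely many points where `f` may differ from the indicator.
  -- There `f` is zero.
  have hinf := hM.infinite_orbit (hC.union (Set.finite_singleton (home L a))) hb
  obtain ⟨_, ⟨⟨τ, hτ⟩, rfl⟩, hτb⟩ := hinf.exists_notMem_finite
    ((ht.finite_diff_interior (definable₁_fib hW.definable_univ a)).union (hfin.image Prod.snd))
  change τ b ∉ _ at hτb
  have hτC : τ ∈ autFixing L C := ⟨hτ.1, fun e he => hτ.2 e (Or.inl he)⟩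
  have hτa : τ a = a := by
    have := Quotient.exact (hτ.2 (home L a) (Or.inr rfl) (fun _ => a) rfl)
    exact congrFun (show (fun _ : Fin 1 => τ a) = fun _ => a from this) 0
  have hval : f (a, τ b) = 0 := by
    have h1 : f (a, τ b) = E.indicator 1 (a, τ b) := by
      by_contra h
      exact hτb (Or.inr ⟨(a, τ b), h, rfl⟩)
    rw [h1, Set.indicator_of_notMem]
    exact fun h => hτb (Or.inl h)
  refine ⟨_, hfin.image Prod.snd, fun σ hσ hσb => ?_⟩
  have hmem : σ b ∈ fib W (σ a) := (hW.mem_fib_iff hσ _ _).2 hab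
  by_contra hint
  have h1 : f (σ a, σ b) = 1 := by
    have : f (σ a, σ b) = E.indicator 1 (σ a, σ b) := by
      by_contra h
      exact hσb ⟨(σ a, σ b), h, rfl⟩
    rw [this, Set.indicator_of_mem (show (σ a, σ b) ∈ E from ⟨hmem, hint⟩)]
    rfl
  -- The pairs `(a, τ b)` and `(σ a, σ b)` are conjugate over `C`, so values `0` and `1` contradict
  -- invariance up to `1 / 3`.
  have h2 := hf (⟨σ, hσ⟩ * ⟨τ, hτC⟩⁻¹) (a, τ b)
  have h3 : ((⟨σ, hσ⟩ * ⟨τ, hτC⟩⁻¹ : autFixing L C) • ((a, τ b) : M × M)) = (σ a, σ b) := by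
    refine Prod.ext ?_ ?_
    · show σ (τ.symm a) = σ a
      rw [τ.symm_apply_eq.2 hτa.symm]
    · show σ (τ.symm (τ b)) = σ b
      rw [τ.symm_apply_apply]
  rw [h3, h1, hval] at h2
  norm_num at h2

/-- The base case of the dimension theory, over finitely many parameters: a single element cannot
be interalgebraic with an independent pair. -/
theorem IsTMinimal.mem_acl_or_mem_acl_of_finite {κ : Cardinal.{w}} (hM : IsMonster L M κ)
    (ht : IsTMinimal L M) {C : Set (MEq L M)} (hC : C.Finite) {a₁ a₂ b : M}
    (h₁ : a₁ ∈ acl L (C ∪ {home L b})) (h₂ : a₂ ∈ acl L (C ∪ {home L b}))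
    (hb : b ∈ acl L (C ∪ {home L a₁, home L a₂})) :
    a₁ ∈ acl L (C ∪ {home L a₂}) ∨ a₂ ∈ acl L (C ∪ {home L a₁}) := by
  by_contra! hcon
  obtain ⟨hn₁, hn₂⟩ := hcon
  have hsing : ∀ x : M, {home L x} = Set.range fun _ : Fin 1 => home L x := fun x =>
    (Set.range_const (c := home L x)).symm
  have htrans : ∀ {x y}, b ∈ acl L (C ∪ {home L x}) → y ∈ acl L (C ∪ {home L b}) →
      y ∈ acl L (C ∪ {home L x}) := by
    intro x y hbx hyb
    refine mem_acl_of_forall_mem_acl (fun _ : Fin 1 => hbx) (acl_mono ?_ hyb)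
    rw [hsing b]
    exact Set.union_subset_union_left _ Set.subset_union_left
  have hb₁ : b ∉ acl L (C ∪ {home L a₁}) := fun h => hn₂ (htrans h h₂)
  have hb₂ : b ∉ acl L (C ∪ {home L a₂}) := fun h => hn₁ (htrans h h₁)
  have hb₀ : b ∉ acl L C := fun h => hb₁ (acl_mono Set.subset_union_left h)
  rw [hsing, mem_acl_union_range_iff] at h₁ h₂
  obtain ⟨W₁, hW₁, hm₁, N₁, hN₁⟩ := h₁
  obtain ⟨W₂, hW₂, hm₂, N₂, hN₂⟩ := h₂
  rw [show ({home L a₁, home L a₂} : Set (MEq L M)) =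
    Set.range fun i : Fin 2 => home L ((![a₁, a₂] : Fin 2 → M) i) by
      ext e; simp [Fin.exists_fin_two, eq_comm], mem_acl_union_range_iff] at hb
  obtain ⟨W, hW, hm, N, hN⟩ := hb
  obtain ⟨F₁, hF₁, hF₁'⟩ := ht.mem_interior_fib_of_conj hM hC hW₁ hN₁ hm₁ hb₁
  obtain ⟨F₂, hF₂, hF₂'⟩ := ht.mem_interior_fib_of_conj hM hC hW₂ hN₂ hm₂ hb₂
  -- Almost all conjugates of `b` lie in this definable set, so it is infinite and has interior.
  let S : Set M := {y | ∃ u : Fin 2 → M, (y ∈ interior (fib W₁ (u 0)) ∧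
    y ∈ interior (fib W₂ (u 1))) ∧ Sum.elim (fun _ => y) u ∈ W}
  have hSinf : S.Infinite := by
    refine (((hM.infinite_orbit hC hb₀).sdiff hF₁).sdiff hF₂).mono ?_
    rintro _ ⟨⟨⟨⟨σ, hσ⟩, rfl⟩, hσ₁⟩, hσ₂⟩
    refine ⟨fun i => σ ((![a₁, a₂] : Fin 2 → M) i), ⟨hF₁' σ hσ hσ₁, hF₂' σ hσ hσ₂⟩, ?_⟩
    rw [← hW.mem_iff_of_mem_autFixing hσ] at hm
    convert hm using 1
    ext (i | i) <;> rfl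
  have hSd : (Set.univ : Set M).Definable₁ L S := by
    have h1 : ∀ {W' : Set (Fin 1 ⊕ Fin 1 → M)}, DefinableOver L C W' → ∀ j : Fin 2,
        (Set.univ : Set M).Definable L {w : Fin 1 ⊕ Fin 2 → M |
          w (Sum.inl 0) ∈ interior (fib W' (w (Sum.inr j)))} := fun {W'} hW' j =>
      ht.definable_interior (V := fun w : Fin 1 ⊕ Fin 2 → M => fib W' (w (Sum.inr j)))
        (definable_fib hW'.definable_univ (Sum.inr 0) (Sum.inl (Sum.inr j)))
        (Set.DefinableFun.proj L)
    have h2 := definable_exists (P := fun (y : Fin 1 → M) (u : Fin 2 → M) =>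
      (y 0 ∈ interior (fib W₁ (u 0)) ∧ y 0 ∈ interior (fib W₂ (u 1))) ∧
        Sum.elim (fun _ => y 0) u ∈ W) (((h1 hW₁ 0).inter (h1 hW₂ 1)).inter (by
          show (Set.univ : Set M).Definable L {w : Fin 1 ⊕ Fin 2 → M |
            Sum.elim (fun _ => w (Sum.inl 0)) (w ∘ Sum.inr) ∈ W}
          convert hW.definable_univ using 1
          ext w
          show Sum.elim _ _ ∈ W ↔ w ∈ W
          congr! 1
          ext (i | i)
          · simp [Subsingleton.elim i 0]
          · rfl))
    exact h2
  obtain ⟨O₁, hO₁S, hO₁, y₁, hy₁, hc₁⟩ := exists_isOpen_forall_mem_interior_iff hN₁.fib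
    isOpen_interior ((ht.interior_nonempty_iff S hSd).2 hSinf)
  obtain ⟨O₂, hO₂₁, hO₂, y₂, hy₂, hc₂⟩ := exists_isOpen_forall_mem_interior_iff hN₂.fib
    hO₁ ⟨y₁, hy₁⟩
  refine ht.infinite_of_isOpen hO₂ ⟨y₂, hy₂⟩ ?_
  -- On `O₂` both entries of the witness `u` range over fixed finite sets, and each pair is
  -- compatible with finitely many points.
  have hsub : O₂ ⊆ ⋃ x₁ ∈ {x | y₁ ∈ fib W₁ x}, ⋃ x₂ ∈ {x | y₂ ∈ fib W₂ x},
      {y | Sum.elim (fun _ => y) (![x₁, x₂] : Fin 2 → M) ∈ W} := by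
    intro y hy
    obtain ⟨u, ⟨hu₁, hu₂⟩, hu⟩ := interior_subset (hO₁S (hO₂₁ hy))
    refine Set.mem_biUnion (interior_subset (s := fib W₁ _) ((hc₁ y (hO₂₁ hy) _).1 hu₁))
      (Set.mem_biUnion (interior_subset (s := fib W₂ _) ((hc₂ y hy _).1 hu₂)) ?_)
    show _ ∈ W
    rwa [show ![u 0, u 1] = u by ext i; fin_cases i <;> rfl]
  exact ((hN₁.fib y₁).1.biUnion fun x₁ _ => (hN₂.fib y₂).1.biUnion fun x₂ _ => (hN _).1).subset hsub

theorem IsTMinimal.mem_acl_or_mem_acl {κ : Cardinal.{w}} (hM : IsMonster L M κ)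
    (ht : IsTMinimal L M) {C : Set (MEq L M)} {a₁ a₂ b : M}
    (h₁ : a₁ ∈ acl L (C ∪ {home L b})) (h₂ : a₂ ∈ acl L (C ∪ {home L b}))
    (hb : b ∈ acl L (C ∪ {home L a₁, home L a₂})) :
    a₁ ∈ acl L (C ∪ {home L a₂}) ∨ a₂ ∈ acl L (C ∪ {home L a₁}) := by
  obtain ⟨C₁, hC₁, hf₁, h₁⟩ := acl_union_exists_finite h₁
  obtain ⟨C₂, hC₂, hf₂, h₂⟩ := acl_union_exists_finite h₂
  obtain ⟨C₃, hC₃, hf₃, hb⟩ := acl_union_exists_finite hb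
  have hsub : C₁ ∪ C₂ ∪ C₃ ⊆ C := Set.union_subset (Set.union_subset hC₁ hC₂) hC₃
  refine (ht.mem_acl_or_mem_acl_of_finite hM ((hf₁.union hf₂).union hf₃)
    (acl_mono (Set.union_subset_union_left _ ?_) h₁)
    (acl_mono (Set.union_subset_union_left _ ?_) h₂)
    (acl_mono (Set.union_subset_union_left _ Set.subset_union_right) hb)).imp
    (fun h => acl_mono (Set.union_subset_union_left _ hsub) h)
    (fun h => acl_mono (Set.union_subset_union_left _ hsub) h)
  · exact Set.subset_union_left.trans Set.subset_union_left
  · exact Set.subset_union_right.trans Set.subset_union_left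

end Pairs

/-! ### Dimension of tuples. -/

section Dimension

variable {L : FirstOrder.Language.{u, v}} {M : Type w} [L.Structure M]

theorem aclIndependent_iff {C : Set (MEq L M)} {n : ℕ} {a : Fin n → M} :
    AclIndependent L C a ↔ ∀ i, a i ∉ aclOver L C (a '' {j | j ≠ i}) := by
  simp only [AclIndependent, aclOver, Set.image_image]

theorem interalgebraic_iff {C : Set (MEq L M)} {n m : ℕ} {a : Fin n → M} {b : Fin m → M} :
    Interalgebraic L C a b ↔
      Set.range a ⊆ aclOver L C (Set.range b) ∧ Set.range b ⊆ aclOver L C (Set.range a) := by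
  simp only [Interalgebraic, aclOver, Set.range_subset_iff, ← Set.range_comp, Function.comp_def]

theorem AclIndependent.injective {C : Set (MEq L M)} {n : ℕ} {a : Fin n → M}
    (h : AclIndependent L C a) : Function.Injective a := by
  intro i j hij
  by_contra hne
  exact aclIndependent_iff.1 h i (subset_aclOver C _ ⟨j, fun h => hne h.symm, hij.symm⟩)

open Classical in
theorem AclIndependent.indepOver {C : Set (MEq L M)} {n : ℕ} {a : Fin n → M}
    (h : AclIndependent L C a) : IndepOver (aclOver L C) ∅ (Finset.univ.image a) := by
  intro x hx
  obtain ⟨i, -, rfl⟩ := Finset.mem_image.1 hx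
  refine fun hi => aclIndependent_iff.1 h i (aclOver_mono C ?_ hi)
  rintro y (hy | ⟨hy, hyi⟩)
  · exact hy.elim
  · obtain ⟨j, -, rfl⟩ := Finset.mem_image.1 hy
    exact ⟨j, fun hj => hyi (by rw [hj]; rfl), rfl⟩

open Classical in
theorem aclIndependent_of_indepOver {C : Set (MEq L M)} {n : ℕ} {a : Fin n → M}
    (ha : Function.Injective a) {I : Finset M} (hI : IndepOver (aclOver L C) ∅ I)
    (haI : ∀ i, a i ∈ I) : AclIndependent L C a := by
  refine aclIndependent_iff.2 fun i hi => hI (a i) (haI i) (aclOver_mono C ?_ hi)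
  rintro _ ⟨j, hj, rfl⟩
  exact Or.inr ⟨haI j, fun h => hj (ha h)⟩

theorem exists_aclIndependent_interalgebraic (C : Set (MEq L M)) {n : ℕ} (a : Fin n → M) :
    ∃ (d : ℕ) (b : Fin d → M), AclIndependent L C b ∧ Interalgebraic L C a b := by
  classical
  obtain ⟨I, hIJ, hI, hJ⟩ := exists_basis (subset_aclOver C) (fun h => aclOver_idem C h) ∅
    (Finset.univ.image a)
  let b : Fin I.card → M := fun i => I.equivFin.symm i
  have hb : Set.range b = I := by
    ext x
    constructor
    · rintro ⟨i, rfl⟩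
      exact (I.equivFin.symm i).2
    · intro hx
      exact ⟨I.equivFin ⟨x, hx⟩, by simp [b]⟩
  refine ⟨I.card, b, aclIndependent_of_indepOver
    (Subtype.val_injective.comp I.equivFin.symm.injective) hI fun i => (I.equivFin.symm i).2,
    interalgebraic_iff.2 ⟨?_, ?_⟩⟩
  · rw [hb]; simpa using hJ
  · rw [hb]
    refine Set.Subset.trans (fun x hx => ?_) (subset_aclOver C _)
    simpa using hIJ hx

variable [TopologicalSpace M]

theorem IsTMinimal.aclOver_pair {κ : Cardinal.{w}} (hM : IsMonster L M κ) (ht : IsTMinimal L M)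
    (C : Set (MEq L M)) (B : Set M) (x y b : M) (hx : x ∈ aclOver L C (insert b B))
    (hy : y ∈ aclOver L C (insert b B)) (hb : b ∈ aclOver L C (insert x (insert y B))) :
    x ∈ aclOver L C (insert y B) ∨ y ∈ aclOver L C (insert x B) := by
  have h1 : ∀ b, aclOver L C (insert b B) = acl L ((C ∪ home L '' B) ∪ {home L b}) := by
    intro b
    rw [aclOver, Set.image_insert_eq, Set.insert_eq, Set.union_comm {_}, Set.union_assoc]
  have h2 : aclOver L C (insert x (insert y B)) =
      acl L ((C ∪ home L '' B) ∪ {home L x, home L y}) := by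
    rw [aclOver, Set.image_insert_eq, Set.image_insert_eq, Set.union_assoc]
    congr 2
    ext e
    simp only [Set.mem_insert_iff, Set.mem_union, Set.mem_singleton_iff]
    tauto
  rw [h1] at hx hy ⊢
  rw [h2] at hb
  rw [h1]
  exact ht.mem_acl_or_mem_acl hM hx hy hb

-- A basis among the entries of `b` has exactly `n` elements. This yields both `n ≤ m` and, when `m
-- = n`, the independence of `b`.
open Classical in
theorem IsTMinimal.exists_indepOver_card {κ : Cardinal.{w}} (hM : IsMonster L M κ)
    (ht : IsTMinimal L M) {C : Set (MEq L M)} {n m : ℕ} {a : Fin n → M} {b : Fin m → M}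
    (ha : AclIndependent L C a) (hab : Interalgebraic L C a b) :
    ∃ I ⊆ Finset.univ.image b, IndepOver (aclOver L C) ∅ I ∧ I.card = n := by
  obtain ⟨I, hIJ, hI, hJ⟩ := exists_basis (subset_aclOver C) (fun h => aclOver_idem C h) ∅
    (Finset.univ.image b)
  refine ⟨I, hIJ, hI, ?_⟩
  obtain ⟨h1, h2⟩ := interalgebraic_iff.1 hab
  have hbI : Set.range b ⊆ aclOver L C (∅ ∪ (I : Set M)) := by simpa using hJ
  have hIb : (I : Set M) ⊆ Set.range b := fun x hx => by simpa using hIJ hx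
  rw [card_eq_of_indepOver (fun h => aclOver_mono C h) (subset_aclOver C)
    (fun h => aclOver_idem C h) (ht.aclOver_pair hM C) hI ha.indepOver (by simpa using hIb.trans h2)
    (by simpa using h1.trans (aclOver_idem C hbI)), Finset.card_image_of_injective _ ha.injective,
    Finset.card_fin]

theorem IsTMinimal.le_of_interalgebraic {κ : Cardinal.{w}} (hM : IsMonster L M κ)
    (ht : IsTMinimal L M) {C : Set (MEq L M)} {n m : ℕ} {a : Fin n → M} {b : Fin m → M}
    (ha : AclIndependent L C a) (hab : Interalgebraic L C a b) : n ≤ m := by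
  classical
  obtain ⟨I, hI, -, rfl⟩ := ht.exists_indepOver_card hM ha hab
  exact (Finset.card_le_card hI).trans (Finset.card_image_le.trans (Finset.card_fin m).le)

theorem IsTMinimal.eq_of_interalgebraic {κ : Cardinal.{w}} (hM : IsMonster L M κ)
    (ht : IsTMinimal L M) {C : Set (MEq L M)} {n m : ℕ} {a : Fin n → M} {b : Fin m → M}
    (hab : Interalgebraic L C a b) (ha : AclIndependent L C a) (hb : AclIndependent L C b) :
    n = m :=
  (ht.le_of_interalgebraic hM ha hab).antisymm (ht.le_of_interalgebraic hM hb ⟨hab.2, hab.1⟩)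

theorem IsTMinimal.aclIndependent_of_interalgebraic {κ : Cardinal.{w}} (hM : IsMonster L M κ)
    (ht : IsTMinimal L M) {C : Set (MEq L M)} {n : ℕ} {a b : Fin n → M}
    (ha : AclIndependent L C a) (hab : Interalgebraic L C a b) : AclIndependent L C b := by
  classical
  obtain ⟨I, hIJ, hI, hcard⟩ := ht.exists_indepOver_card hM ha hab
  have hle : (Finset.univ.image b).card ≤ n := Finset.card_image_le.trans (Finset.card_fin n).le
  have hIeq : I = Finset.univ.image b := Finset.eq_of_subset_of_card_le hIJ (hle.trans hcard.ge)
  have hinj : Function.Injective b := by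
    have := (Finset.card_image_iff (s := Finset.univ) (f := b)).1
      (by rw [← hIeq, hcard, Finset.card_fin])
    simpa using this
  exact aclIndependent_of_indepOver hinj hI fun i => by rw [hIeq]; simp

end Dimension

/-! ### Broad sets and independent tuples. -/

section Grids

variable {L : FirstOrder.Language.{u, v}} {M : Type w} [L.Structure M]

theorem Broad.mono {n : ℕ} {R R' : Set (Fin n → M)} (h : R ⊆ R') (hR : Broad R) : Broad R' :=
  fun k => let ⟨S, hS, hSR⟩ := hR k; ⟨S, hS, hSR.trans h⟩

/-- The set of tuples `x` such that `(x i, (x j)_{j ≠ i}) ∈ W`. -/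
def splitAt {n : ℕ} (i : Fin n) (W : Set (Fin 1 ⊕ {j : Fin n // j ≠ i} → M)) :
    Set (Fin n → M) :=
  {x | Sum.elim (fun _ => x i) (fun j => x j.1) ∈ W}

/-- The other coordinates determine the `i`-th one up to `N` choices. The extra factor `k` avoids
the exponent `n - 1`. -/
theorem card_filter_splitAt_mul_le {n k N : ℕ} {i : Fin n}
    {W : Set (Fin 1 ⊕ {j : Fin n // j ≠ i} → M)} (hW : BoundedFibers N W) {S : Fin n → Finset M}
    (hS : ∀ i, (S i).card = k) [DecidablePred (· ∈ splitAt i W)] :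
    ((Fintype.piFinset S).filter (· ∈ splitAt i W)).card * k ≤ N * k ^ n := by
  classical
  have h := Finset.card_le_mul_card_image_of_maps_to
    (s := (Fintype.piFinset S).filter (· ∈ splitAt i W))
    (t := Fintype.piFinset fun j : {j : Fin n // j ≠ i} => S j) (f := fun x j => x j.1)
    (by
      intro x hx
      rw [Fintype.mem_piFinset]
      exact fun j => Fintype.mem_piFinset.1 (Finset.mem_filter.1 hx).1 j) N (by
      intro v _
      refine le_trans ?_ (hW v).2
      rw [Set.ncard_eq_toFinset_card _ (hW v).1]
      refine Finset.card_le_card_of_injOn (fun x => x i) ?_ ?_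
      · intro x hx
        simp only [Finset.coe_filter, Finset.mem_filter, Set.mem_ofPred_eq] at hx
        obtain ⟨⟨-, hx⟩, rfl⟩ := hx
        simpa [splitAt] using hx
      · intro x hx y hy hxy
        simp only [Finset.coe_filter, Finset.mem_filter, Set.mem_ofPred_eq] at hx hy
        ext j
        by_cases hj : j = i
        · rw [hj]; exact hxy
        · exact congrFun (hx.2.trans hy.2.symm) ⟨j, hj⟩)
  obtain ⟨n, rfl⟩ : ∃ n', n = n' + 1 := ⟨n - 1, by have := i.2; omega⟩
  rw [Fintype.card_piFinset] at h
  simp only [hS, Finset.prod_const, Finset.card_univ, Fintype.card_subtype_compl,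
    Fintype.card_fin, Fintype.card_unique, Nat.add_sub_cancel] at h
  calc _ ≤ N * k ^ n * k := Nat.mul_le_mul_right _ (by simpa using h)
    _ = N * k ^ (n + 1) := by ring

/-- A broad set is not covered by finitely many sets with bounded fibres in some direction. -/
theorem Broad.exists_notMem_splitAt {n : ℕ} {D : Set (Fin n → M)} (hD : Broad D) {Q : Type*}
    [Finite Q] (i : Q → Fin n) (N : Q → ℕ)
    (W : ∀ q, Set (Fin 1 ⊕ {j : Fin n // j ≠ i q} → M)) (hW : ∀ q, BoundedFibers (N q) (W q)) :
    ∃ x ∈ D, ∀ q, x ∉ splitAt (i q) (W q) := by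
  classical
  cases nonempty_fintype Q
  by_contra! hcon
  -- A grid of side `k` has `k ^ n` points, of which the given sets cover at most the fraction `(∑
  -- q, N q) / k`, which is less than one.
  set k := ∑ q, N q + 1 with hk
  obtain ⟨S', hS', hSD⟩ := hD k
  choose S hSS' hS using fun i => Finset.exists_subset_card_eq (hS' i)
  have hcov : Fintype.piFinset S ⊆ Finset.univ.biUnion fun q =>
      (Fintype.piFinset S).filter (· ∈ splitAt (i q) (W q)) := by
    intro x hx
    obtain ⟨q, hq⟩ := hcon x (hSD fun i => hSS' i (Fintype.mem_piFinset.1 hx i))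
    exact Finset.mem_biUnion.2 ⟨q, Finset.mem_univ _, Finset.mem_filter.2 ⟨hx, hq⟩⟩
  have h1 := (Finset.card_le_card hcov).trans Finset.card_biUnion_le
  rw [Fintype.card_piFinset] at h1
  simp only [hS, Finset.prod_const, Finset.card_univ, Fintype.card_fin] at h1
  have h2 : k ^ n * k ≤ (∑ q, N q) * k ^ n := by
    calc k ^ n * k ≤ _ := Nat.mul_le_mul_right k h1
      _ ≤ _ := by
        rw [Finset.sum_mul, Finset.sum_mul]
        exact Finset.sum_le_sum fun q _ => card_filter_splitAt_mul_le (hW q) hS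
  rw [mul_comm] at h2
  have h3 := Nat.le_of_mul_le_mul_right h2 (pow_pos (by omega) n)
  omega

theorem exists_splitAt_of_not_aclIndependent {C : Set (MEq L M)} {n : ℕ} {a : Fin n → M} :
    ¬ AclIndependent L C a ↔ ∃ (i : Fin n) (W : Set (Fin 1 ⊕ {j : Fin n // j ≠ i} → M)) (N : ℕ),
      DefinableOver L C W ∧ BoundedFibers N W ∧ a ∈ splitAt i W := by
  simp only [AclIndependent, not_forall, not_not]
  refine exists_congr fun i => ?_
  have : (fun j => home L (a j)) '' {j | j ≠ i} =
      Set.range fun j : {j : Fin n // j ≠ i} => home L (a j) := by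
    ext e; simp
  rw [this, mem_acl_union_range_iff]
  exact ⟨fun ⟨W, hW, ha, N, hN⟩ => ⟨W, N, hW, hN, ha⟩, fun ⟨W, N, hW, hN, ha⟩ => ⟨W, hW, ha, N, hN⟩⟩

theorem DefinableOver.splitAt {C : Set (MEq L M)} {n : ℕ} {i : Fin n}
    {W : Set (Fin 1 ⊕ {j : Fin n // j ≠ i} → M)} (hW : DefinableOver L C W) :
    DefinableOver L C (splitAt i W) := by
  convert hW.preimage_comp (Sum.elim (fun _ => i) fun j => j.1) using 1
  ext x
  show Sum.elim _ _ ∈ W ↔ _ ∈ W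
  congr! 1
  ext (j | j) <;> rfl

/-- A dependence of `a` would confine all realizations of its type to one set with bounded fibres.
No saturation is involved, so `C` may be large. -/
theorem aclIndependent_of_broad_typeSet {C : Set (MEq L M)} {n : ℕ} {a : Fin n → M}
    (h : Broad (typeSet L C a)) : AclIndependent L C a := by
  by_contra hcon
  obtain ⟨i, W, N, hW, hN, ha⟩ := exists_splitAt_of_not_aclIndependent.1 hcon
  obtain ⟨x, hx, hxW⟩ := h.exists_notMem_splitAt (Q := Unit) (fun _ => i) (fun _ => N)
    (fun _ => W) fun _ => hN
  exact hxW () (hx _ hW.splitAt ha)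

/-- A broad definable set contains a point whose coordinates are independent over any given finite
set of parameters. -/
theorem IsMonster.exists_aclIndependent {κ : Cardinal.{w}} (hM : IsMonster L M κ)
    {C : Set (MEq L M)} (hC : C.Finite) {n : ℕ} {D : Set (Fin n → M)} (hD : Broad D)
    (hDC : DefinableOver L C D) : ∃ a ∈ D, AclIndependent L C a := by
  obtain ⟨y, hy⟩ := exists_isRep C
  have : Finite C := hC
  let P : Type w := Σ i : Fin n, {p : Set (Fin 1 ⊕ {j : Fin n // j ≠ i} → M) × ℕ //
    DefinableOver L C p.1 ∧ BoundedFibers p.2 p.1}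
  -- Independence over `C` means avoiding all sets with bounded fibres that are definable over `C`;
  -- finitely many can be avoided inside `D` by counting.
  let T : P → Set (Fin n → M) := fun p => D ∩ (splitAt p.1 p.2.1.1)ᶜ
  obtain ⟨a, ha⟩ := hM.saturated.exists_mem_all (A := Set.range y)
    ((Set.finite_range y).lt_aleph0.trans hM.aleph0_lt) (insert D (Set.range T)) (by
      rintro _ (rfl | ⟨p, rfl⟩)
      · exact hDC.definable_range hy
      · exact (hDC.inter p.2.2.1.splitAt.compl).definable_range hy) (by
      intro 𝒮₀ h𝒮₀ hfin
      have hsub : 𝒮₀ \ {D} ⊆ T '' Set.univ := by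
        rintro X ⟨hX, hXD⟩
        rw [Set.image_univ]
        exact (h𝒮₀ hX).resolve_left hXD
      obtain ⟨Q, -, hQ, hQ'⟩ := (hfin.subset Set.sdiff_subset).exists_subset_finite_image_eq hsub
      have : Finite Q := hQ
      obtain ⟨x, hxD, hx⟩ := hD.exists_notMem_splitAt (Q := Q) (fun q => q.1.1)
        (fun q => q.1.2.1.2) (fun q => q.1.2.1.1) fun q => q.1.2.2.2
      refine ⟨x, fun X hX => ?_⟩
      by_cases hXD : X = D
      · rwa [hXD]
      · obtain ⟨q, hq, rfl⟩ : X ∈ T '' Q := hQ' ▸ ⟨hX, hXD⟩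
        exact ⟨hxD, hx ⟨q, hq⟩⟩)
  refine ⟨a, ha D (Or.inl rfl), ?_⟩
  by_contra hcon
  obtain ⟨i, W, N, hW, hN, haW⟩ := exists_splitAt_of_not_aclIndependent.1 hcon
  exact (ha (T ⟨i, (W, N), hW, hN⟩) (Or.inr ⟨_, rfl⟩)).2 haW

theorem definableOver_home_image {A : Set M} {α : Type} {X : Set (α → M)} (h : A.Definable L X) :
    DefinableOver L (home L '' A) X := by
  obtain ⟨φ, hφ⟩ := Set.definable_iff_exists_formula_sum.1 h
  rw [definableOver_iff]
  refine ⟨φ.relabel (Sum.elim (fun a => Sum.inr ⟨⟨home L a.1, a.1, a.2, rfl⟩, 0⟩) Sum.inl),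
    fun y hy x => ?_⟩
  rw [Formula.realize_relabel, hφ, Set.mem_ofPred_eq]
  congr! 1
  ext (a | i)
  · have := Quotient.exact (hy ⟨home L a.1, a.1, a.2, rfl⟩)
    exact (congrFun (show (fun j => y ⟨⟨home L a.1, a.1, a.2, rfl⟩, j⟩) =
      fun _ : Fin 1 => a.1 from this) 0).symm
  · rfl

/-- If every set that is definable over the small set `C` and contains `b` is broad, then the type
of `b` over `C` is broad. -/
theorem IsMonster.broad_typeSet {κ : Cardinal.{w}} (hM : IsMonster L M κ) {C : Set (MEq L M)}
    (hC : Cardinal.mk C < κ) {n : ℕ} {b : Fin n → M}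
    (h : ∀ Y : Set (Fin n → M), DefinableOver L C Y → b ∈ Y → Broad Y) :
    Broad (typeSet L C b) := by
  classical
  intro k
  obtain ⟨y, hy⟩ := exists_isRep C
  have hcard : Cardinal.mk (Set.range y) < κ := by
    refine Cardinal.mk_range_le.trans_lt ?_
    rw [Cardinal.mk_sigma]
    refine (Cardinal.sum_le_sum _ (fun _ => Cardinal.aleph0) fun e => ?_).trans_lt ?_
    · exact (Cardinal.mk_le_aleph0)
    · rw [Cardinal.sum_const, Cardinal.lift_uzero, Cardinal.lift_aleph0]
      exact Cardinal.mul_lt_of_lt hM.aleph0_lt.le hC hM.aleph0_lt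
  let I : Set (Fin n × Fin k → M) :=
    {z | ∀ (i : Fin n) (j j' : Fin k), j ≠ j' → z (i, j) ≠ z (i, j')}
  -- A variable `z (i, j)` stands for the `j`-th element of the `i`-th side of a grid, and `T Y`
  -- says that the whole grid lies in `Y`.
  let T : Set (Fin n → M) → Set (Fin n × Fin k → M) := fun Y =>
    ⋂ f : Fin n → Fin k, {z | z ∘ (fun i => (i, f i)) ∈ Y}
  obtain ⟨z, hz⟩ := hM.saturated.exists_mem_all hcard
    (insert I (T '' {Y | DefinableOver L C Y ∧ b ∈ Y})) (by
      rintro _ (rfl | ⟨Y, ⟨hY, -⟩, rfl⟩)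
      · have hI : I = ⋂ i : Fin n, ⋂ p : {p : Fin k × Fin k // p.1 ≠ p.2},
            {z : Fin n × Fin k → M | z (i, p.1.1) = z (i, p.1.2)}ᶜ := by
          ext z; simp [I]
        rw [hI]
        exact (DefinableOver.iInter_of_finite fun i => DefinableOver.iInter_of_finite fun p =>
          (definableOver_eq C _ _).compl).definable_range hy
      · exact (DefinableOver.iInter_of_finite fun f => hY.preimage_comp _).definable_range hy) (by
      intro 𝒮₀ h𝒮₀ hfin
      have hsub : 𝒮₀ \ {I} ⊆ T '' {Y | DefinableOver L C Y ∧ b ∈ Y} := by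
        rintro X ⟨hX, hXI⟩
        exact (h𝒮₀ hX).resolve_left hXI
      obtain ⟨Q, hQ, hQfin, hQ'⟩ :=
        (hfin.subset Set.sdiff_subset).exists_subset_finite_image_eq hsub
      have : Finite Q := hQfin
      obtain ⟨S, hS, hSY⟩ := h (⋂ Y : Q, Y.1)
        (DefinableOver.iInter_of_finite fun Y => (hQ Y.2).1)
        (Set.mem_iInter.2 fun Y => (hQ Y.2).2) k
      refine ⟨fun p => (S p.1).equivFin.symm (Fin.castLE (hS p.1) p.2), fun X hX => ?_⟩
      by_cases hXI : X = I
      · rw [hXI]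
        intro i j j' hjj' heq
        exact hjj' (Fin.castLE_injective (hS i)
          ((S i).equivFin.symm.injective (Subtype.ext heq)))
      · obtain ⟨Y, hY, rfl⟩ : X ∈ T '' Q := hQ' ▸ ⟨hX, hXI⟩
        refine Set.mem_iInter.2 fun f => ?_
        exact Set.mem_iInter.1 (hSY fun i => Subtype.prop _) ⟨Y, hY⟩)
  have hI := hz I (Or.inl rfl)
  refine ⟨fun i => Finset.univ.image fun j => z (i, j), fun i => ?_, fun x hx Y hY hb => ?_⟩
  · rw [Finset.card_image_of_injective _ fun j j' h => by_contra fun hj => hI i j j' hj h,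
      Finset.card_fin]
  · have hx' : ∀ i, ∃ j, z (i, j) = x i := fun i => by simpa using hx i
    choose f hf using hx'
    have := Set.mem_iInter.1 (hz (T Y) (Or.inr ⟨Y, ⟨hY, hb⟩, rfl⟩)) f
    rwa [show x = z ∘ fun i => (i, f i) from funext fun i => (hf i).symm]

end Grids

/-! ### Large grids around independent tuples. -/

section Boxes

variable {L : FirstOrder.Language.{u, v}} {M : Type w} [L.Structure M]

theorem apply_eq_of_mem_autFixing {C : Set (MEq L M)} {σ : Equiv.Perm M}
    (hσ : σ ∈ autFixing L C) {a : M} (ha : home L a ∈ C) : σ a = a := by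
  have := Quotient.exact (hσ.2 (home L a) ha (fun _ => a) rfl)
  exact congrFun (show (fun _ : Fin 1 => σ a) = fun _ => a from this) 0

theorem autFixing_anti {C C' : Set (MEq L M)} (h : C ⊆ C') : autFixing L C' ≤ autFixing L C :=
  fun _ hσ => ⟨hσ.1, fun e he => hσ.2 e (h he)⟩

variable [TopologicalSpace M]

/-- Automorphisms fixing the parameters of the topology are homeomorphisms. -/
theorem mem_interior_iff_of_mem_autFixing {l m : ℕ} {t : Fin l → M}
    {β : L.Formula ((Fin l ⊕ Fin m) ⊕ Fin 1)} (hβ : ∀ V : Set M, interior V = intAt β t V)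
    {C : Set (MEq L M)} (htC : ∀ i, home L (t i) ∈ C) {σ : Equiv.Perm M}
    (hσ : σ ∈ autFixing L C) (V : Set M) (y : M) :
    σ y ∈ interior V ↔ y ∈ interior (σ ⁻¹' V) := by
  have := mem_intAt_iff_of_mem_autFixing hσ β t V y
  rwa [show (fun i => σ (t i)) = t from funext fun i => apply_eq_of_mem_autFixing hσ (htC i),
    ← hβ, ← hβ] at this

/-- A definable set that is invariant under the automorphisms fixing `C`, where `C` defines the
topology, is broad if it contains a tuple that is independent over `C`. -/
theorem IsTMinimal.broad_of_aclIndependent {κ : Cardinal.{w}} (hM : IsMonster L M κ)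
    (ht : IsTMinimal L M) {l m : ℕ} {t : Fin l → M}
    {β : L.Formula ((Fin l ⊕ Fin m) ⊕ Fin 1)} (hβ : ∀ V : Set M, interior V = intAt β t V)
    (n : ℕ) {C : Set (MEq L M)} (hC : C.Finite) (htC : ∀ i, home L (t i) ∈ C)
    {Y : Set (Fin n → M)} (hY : (Set.univ : Set M).Definable L Y)
    (hinv : ∀ σ ∈ autFixing L C, ∀ x : Fin n → M, (fun i => σ (x i)) ∈ Y ↔ x ∈ Y)
    {b : Fin n → M} (hbY : b ∈ Y) (hb : AclIndependent L C b) : Broad Y := by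
  classical
  induction n generalizing C with
  | zero =>
    refine fun k => ⟨fun _ => ∅, fun i => i.elim0, fun x _ => ?_⟩
    rwa [Subsingleton.elim x b]
  | succ n ih =>
    let V : (Fin n → M) → Set M := fun x => {y | Fin.cons y x ∈ Y}
    let Z : Set (Fin n → M) := {x | b 0 ∈ interior (V x)}
    have hVd : (Set.univ : Set M).Definable L
        {w : Fin n ⊕ Fin 1 → M | w (Sum.inr 0) ∈ V (w ∘ Sum.inl)} :=
      hY.preimage_map (F := fun w : Fin n ⊕ Fin 1 → M =>
        (Fin.cons (w (Sum.inr 0)) (w ∘ Sum.inl) : Fin (n + 1) → M)) fun i => by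
          refine Fin.cases ?_ (fun i => ?_) i
          · exact Set.DefinableFun.proj L
          · exact Set.DefinableFun.proj L
    have hVd₁ : ∀ x, (Set.univ : Set M).Definable₁ L (V x) := fun x =>
      hY.preimage_map (F := fun w : Fin 1 → M => (Fin.cons (w 0) x : Fin (n + 1) → M))
        fun i => by
          refine Fin.cases ?_ (fun i => ?_) i
          · exact Set.DefinableFun.proj L
          · exact L.definableFun_const _ (Set.mem_univ _)
    have hZd : (Set.univ : Set M).Definable L Z :=
      ht.definable_interior hVd (f := fun _ => b 0) (L.definableFun_const _ (Set.mem_univ _))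
    have hpre : ∀ σ ∈ autFixing L C, ∀ x : Fin n → M,
        σ ⁻¹' V (fun i => σ (x i)) = V x := by
      intro σ hσ x
      ext y
      show Fin.cons (σ y) (fun i => σ (x i)) ∈ Y ↔ Fin.cons y x ∈ Y
      rw [← hinv σ hσ (Fin.cons y x)]
      congr! 1
      ext i
      refine Fin.cases ?_ (fun i => ?_) i <;> simp
    have hcons : Fin.cons (b 0) (Fin.tail b) = b := Fin.cons_self_tail b
    -- the tail of `b` lies in `Z`
    have hbZ : Fin.tail b ∈ Z := by
      set C' := C ∪ (fun j => home L (b j)) '' {j | j ≠ 0}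
      -- Over `C` and the tail, `b 0` has a conjugate outside the finite set of non-interior points
      -- of its slice; as the conjugating automorphism preserves interiors, `b 0` is itself
      -- interior.
      have hinf := hM.infinite_orbit (hC.union ((Set.toFinite _).image _)) (hb 0)
      obtain ⟨_, ⟨⟨τ, hτ⟩, rfl⟩, hτb⟩ := hinf.exists_notMem_finite
        (ht.finite_diff_interior (hVd₁ (Fin.tail b)))
      change τ (b 0) ∉ _ at hτb
      have hτC : τ ∈ autFixing L C := autFixing_anti Set.subset_union_left hτ
      have hfix : (fun i => τ (Fin.tail b i)) = Fin.tail b := funext fun i =>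
        apply_eq_of_mem_autFixing hτ (Or.inr ⟨i.succ, Fin.succ_ne_zero i, rfl⟩)
      have h1 := hpre τ hτC (Fin.tail b)
      rw [hfix] at h1
      have h2 := mem_interior_iff_of_mem_autFixing hβ htC hτC (V (Fin.tail b)) (b 0)
      rw [h1] at h2
      refine h2.1 (by_contra fun h => hτb ⟨?_, h⟩)
      have h3 : b 0 ∈ V (Fin.tail b) := by
        show Fin.cons (b 0) (Fin.tail b) ∈ Y
        rwa [hcons]
      rw [← h1] at h3
      exact h3
    have hZ : Broad Z := by
      refine ih (C := C ∪ {home L (b 0)}) (hC.union (Set.finite_singleton _))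
        (fun i => Or.inl (htC i)) hZd (fun σ hσ x => ?_) hbZ fun i hi => ?_
      · have hσC : σ ∈ autFixing L C := autFixing_anti Set.subset_union_left hσ
        show b 0 ∈ interior (V _) ↔ b 0 ∈ interior (V x)
        have h := mem_interior_iff_of_mem_autFixing hβ htC hσC (V fun i => σ (x i)) (b 0)
        rwa [hpre σ hσC, apply_eq_of_mem_autFixing hσ (Or.inr rfl)] at h
      · refine hb i.succ (acl_mono ?_ hi)
        rintro e ((he | he) | ⟨j, hj, rfl⟩)
        · exact Or.inl he
        · exact Or.inr ⟨0, (Fin.succ_ne_zero i).symm, he.symm⟩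
        · exact Or.inr ⟨j.succ, fun h => hj (Fin.succ_injective _ h), rfl⟩
    intro k
    obtain ⟨S, hS, hSZ⟩ := hZ k
    -- All slices over the finite grid in `Z` contain `b 0` in their interior. Any `k` points of
    -- their common interior extend the grid by one coordinate.
    have hopen : IsOpen (⋂ x ∈ Fintype.piFinset S, interior (V x)) :=
      isOpen_biInter_finset fun _ _ => isOpen_interior
    have hne : (⋂ x ∈ Fintype.piFinset S, interior (V x)).Nonempty :=
      ⟨b 0, Set.mem_iInter₂.2 fun x hx => hSZ fun i => Fintype.mem_piFinset.1 hx i⟩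
    obtain ⟨F, hF, hFk⟩ := (ht.infinite_of_isOpen hopen hne).exists_subset_card_eq k
    refine ⟨Fin.cons F S, fun i => ?_, fun x hx => ?_⟩
    · refine Fin.cases ?_ (fun i => ?_) i
      · simp [hFk]
      · simpa using hS i
    · have h0 := hF (hx 0)
      have h1 := interior_subset (Set.mem_iInter₂.1 h0 (Fin.tail x)
        (Fintype.mem_piFinset.2 fun i => by simpa [Fin.tail] using hx i.succ))
      change Fin.cons (x 0) (Fin.tail x) ∈ Y at h1
      rwa [Fin.cons_self_tail] at h1

end Boxes

/-! ### Broadness under finite-to-finite relations and interalgebraicity. -/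

section Broadness

variable {L : FirstOrder.Language.{u, v}} {M : Type w} [L.Structure M]

theorem coordinate_mem_acl_of_finite {C : Set (MEq L M)} {n m : ℕ}
    {R : (Fin n → M) → (Fin m → M) → Prop}
    (hR : DefinableOver L C {z : Fin n ⊕ Fin m → M | R (z ∘ Sum.inl) (z ∘ Sum.inr)})
    {a : Fin n → M} {b : Fin m → M} (hab : R a b) (hfin : {a | R a b}.Finite) (i : Fin n) :
    a i ∈ acl L (C ∪ Set.range fun j => home L (b j)) := by
  refine ⟨(fun a => a i) '' {a | R a b}, hfin.image _, ⟨a, hab, rfl⟩, ?_⟩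
  have h1 : DefinableOver L C {w : (Fin 1 ⊕ Fin m) ⊕ Fin n → M |
      R (w ∘ Sum.inr) ((w ∘ Sum.inl) ∘ Sum.inr)} :=
    hR.preimage_comp (Sum.elim Sum.inr (Sum.inl ∘ Sum.inr))
  refine definableOver_union_range_home.2 ⟨_, (h1.inter (definableOver_eq C (Sum.inr i)
    (Sum.inl (Sum.inl 0)))).exists_of_finite, fun x => ?_⟩
  rfl

variable [TopologicalSpace M]

/-- A finite-to-finite definable relation between `M^n` and `M^m` with broad domain needs
`n ≤ m`. -/
theorem IsTMinimal.le_of_broad {κ : Cardinal.{w}} (hM : IsMonster L M κ) (ht : IsTMinimal L M)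
    {n m : ℕ} {R : (Fin n → M) → (Fin m → M) → Prop}
    (hR : (Set.univ : Set M).Definable L {z : Fin n ⊕ Fin m → M | R (z ∘ Sum.inl) (z ∘ Sum.inr)})
    (h₁ : ∀ a, {b | R a b}.Finite) (h₂ : ∀ b, {a | R a b}.Finite)
    (hbroad : Broad {a | ∃ b, R a b}) : n ≤ m := by
  obtain ⟨A, -, hA⟩ := Set.definable_iff_finitely_definable.1 hR
  have hRC := definableOver_home_image hA
  obtain ⟨a, ⟨b, hab⟩, ha⟩ := hM.exists_aclIndependent (A.finite_toSet.image (home L)) hbroad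
    hRC.exists_of_finite
  refine ht.le_of_interalgebraic hM ha ⟨fun i => coordinate_mem_acl_of_finite hRC hab (h₂ b) i,
    fun j => coordinate_mem_acl_of_finite (R := fun b a => R a b) ?_ hab (h₁ a) j⟩
  exact hRC.preimage_comp Sum.swap

/-- A set that is definable over `C` and contains a tuple interalgebraic over `C` with a tuple of
broad type is broad. -/
theorem IsTMinimal.broad_of_interalgebraic {κ : Cardinal.{w}} (hM : IsMonster L M κ)
    (ht : IsTMinimal L M) {C : Set (MEq L M)} {n : ℕ} {a b : Fin n → M}
    (ha : Broad (typeSet L C a)) (hab : Interalgebraic L C a b) {Y : Set (Fin n → M)}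
    (hY : DefinableOver L C Y) (hbY : b ∈ Y) : Broad Y := by
  obtain ⟨l, m, t, β, hβ⟩ := exists_interior_eq_intAt ht.definable
  have h₁ := fun i => mem_acl_union_range_iff.1 (hab.1 i)
  have h₂ := fun i => mem_acl_union_range_iff.1 (hab.2 i)
  choose W hW haW N hN using h₁
  choose W' hW' hbW' N' hN' using h₂
  choose C₁ hC₁ hf₁ hd₁ using fun i => (hW i).exists_finite
  choose C₂ hC₂ hf₂ hd₂ using fun i => (hW' i).exists_finite
  obtain ⟨C₃, hC₃, hf₃, hd₃⟩ := hY.exists_finite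
  let C₀ : Set (MEq L M) := ((⋃ i, C₁ i) ∪ (⋃ i, C₂ i)) ∪ C₃
  have hC₀ : C₀ ⊆ C :=
    Set.union_subset (Set.union_subset (Set.iUnion_subset hC₁) (Set.iUnion_subset hC₂)) hC₃
  have hf₀ : C₀.Finite := ((Set.finite_iUnion hf₁).union (Set.finite_iUnion hf₂)).union hf₃
  replace hd₁ : ∀ i, DefinableOver L C₀ (W i) := fun i => (hd₁ i).mono
    (((Set.subset_iUnion C₁ i).trans Set.subset_union_left).trans Set.subset_union_left)
  replace hd₂ : ∀ i, DefinableOver L C₀ (W' i) := fun i => (hd₂ i).mono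
    (((Set.subset_iUnion C₂ i).trans Set.subset_union_right).trans Set.subset_union_left)
  replace hd₃ : DefinableOver L C₀ Y := hd₃.mono Set.subset_union_right
  let R : Set (Fin n ⊕ Fin n → M) :=
    ((⋂ i, {z | z ∘ (Sum.elim (fun _ => Sum.inl i) Sum.inr) ∈ W i}) ∩
      ⋂ i, {z | z ∘ (Sum.elim (fun _ => Sum.inr i) Sum.inl) ∈ W' i}) ∩ {z | z ∘ Sum.inr ∈ Y}
  have hR : DefinableOver L C₀ R :=
    ((DefinableOver.iInter_of_finite fun i => (hd₁ i).preimage_comp _).inter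
      (DefinableOver.iInter_of_finite fun i => (hd₂ i).preimage_comp _)).inter
        (hd₃.preimage_comp _)
  have hiff : ∀ x y : Fin n → M, Sum.elim x y ∈ R ↔
      ((∀ i, Sum.elim (fun _ => x i) y ∈ W i) ∧ ∀ i, Sum.elim (fun _ => y i) x ∈ W' i) ∧
        y ∈ Y := by
    intro x y
    refine and_congr (and_congr (Set.mem_iInter.trans (forall_congr' fun i => ?_))
      (Set.mem_iInter.trans (forall_congr' fun i => ?_))) Iff.rfl
    all_goals
      rw [Set.mem_ofPred_eq]
      congr! 1
      ext (j | j) <;> rfl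
  let D : Set (Fin n → M) := {x | ∃ y, Sum.elim x y ∈ R}
  have hD : DefinableOver L C₀ D := hR.exists_of_finite
  have hDb : Broad D := Broad.mono
    (fun x (hx : x ∈ typeSet L C a) => hx D (hD.mono hC₀) ⟨b, (hiff a b).2 ⟨⟨haW, hbW'⟩, hbY⟩⟩) ha
  -- The given `a` may fail to be independent once the topology parameters `t` are added. The broad
  -- set `D` supplies a replacement `a'` that is independent over them, with a partner `b'` in `Y`.
  let C' : Set (MEq L M) := C₀ ∪ Set.range fun i => home L (t i)
  have hC' : C'.Finite := hf₀.union (Set.finite_range _)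
  have hsub : C₀ ⊆ C' := Set.subset_union_left
  obtain ⟨a', ⟨b', hab'⟩, ha'⟩ := hM.exists_aclIndependent hC' hDb (hD.mono hsub)
  rw [hiff] at hab'
  have hint : Interalgebraic L C' a' b' :=
    ⟨fun i => mem_acl_of_bounded ((hd₁ i).mono hsub) (hab'.1.1 i) (hN i),
      fun i => mem_acl_of_bounded ((hd₂ i).mono hsub) (hab'.1.2 i) (hN' i)⟩
  exact ht.broad_of_aclIndependent hM hβ n hC' (fun i => Or.inr ⟨i, rfl⟩) hY.definable_univ
    (fun σ hσ x => (hd₃.mono hsub).mem_iff_of_mem_autFixing hσ x) hab'.2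
    (ht.aclIndependent_of_interalgebraic hM ha' hint)

end Broadness

end TMin

theorem proposition2p13 (L : FirstOrder.Language.{u, v}) (M : Type w) [L.Structure M]
    (κ : Cardinal.{w}) (hM : TMin.IsMonster L M κ)
    [TopologicalSpace M] (ht : TMin.IsTMinimal L M) :
    -- interalgebraic independent tuples have the same length
    (∀ (C : Set (TMin.MEq L M)) (n m : ℕ) (a : Fin n → M) (b : Fin m → M),
      TMin.Interalgebraic L C a b → TMin.AclIndependent L C a → TMin.AclIndependent L C b →
      n = m) ∧
    -- the dimension of `a` over `C` is well-defined
    (∀ (C : Set (TMin.MEq L M)) (n : ℕ) (a : Fin n → M),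
      ∃! d : ℕ, ∃ b : Fin d → M, TMin.AclIndependent L C b ∧ TMin.Interalgebraic L C a b) ∧
    -- no finite-to-finite definable relation from a broad subset of `M^(n+1)` to `M^n`
    (∀ (n : ℕ) (R : (Fin (n + 1) → M) → (Fin n → M) → Prop),
      (Set.univ : Set M).Definable L
        {z : Fin (n + 1) ⊕ Fin n → M | R (z ∘ Sum.inl) (z ∘ Sum.inr)} →
      (∀ a, {b | R a b}.Finite) → (∀ b, {a | R a b}.Finite) →
      ¬ TMin.Broad {a | ∃ b, R a b}) ∧
    -- a tuple of broad type is not interalgebraic with a shorter one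
    (∀ (C : Set (TMin.MEq L M)) (n : ℕ) (a : Fin (n + 1) → M) (b : Fin n → M),
      TMin.Broad (TMin.typeSet L C a) → ¬ TMin.Interalgebraic L C a b) ∧
    -- broadness of types passes to interalgebraic tuples of the same length
    (∀ (C : Set (TMin.MEq L M)), Cardinal.mk C < κ →
      ∀ (n : ℕ) (a b : Fin (n + 1) → M),
      TMin.Broad (TMin.typeSet L C a) → TMin.Interalgebraic L C a b →
      TMin.Broad (TMin.typeSet L C b)) := by
  refine ⟨fun C n m a b hab ha hb => ht.eq_of_interalgebraic hM hab ha hb, fun C n a => ?_,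
    fun n R hR h₁ h₂ hbroad => ?_, fun C n a b ha hab => ?_, fun C hC n a b ha hab => ?_⟩
  · obtain ⟨d, b, hb, hab⟩ := TMin.exists_aclIndependent_interalgebraic C a
    refine ⟨d, ⟨b, hb, hab⟩, ?_⟩
    rintro d' ⟨b', hb', hab'⟩
    refine ht.eq_of_interalgebraic hM (TMin.interalgebraic_iff.2 ?_) hb' hb
    rw [TMin.interalgebraic_iff] at hab hab'
    exact ⟨hab'.2.trans (TMin.aclOver_idem C hab.1), hab.2.trans (TMin.aclOver_idem C hab'.1)⟩
  · exact absurd (ht.le_of_broad hM hR h₁ h₂ hbroad) (by omega)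
  · exact absurd (ht.le_of_interalgebraic hM (TMin.aclIndependent_of_broad_typeSet ha) hab)
      (by omega)
  · exact hM.broad_typeSet hC fun Y hY hbY => ht.broad_of_interalgebraic hM ha hab hY hbY
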